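/- **Setting.** A Markov chain $(\mathcal X,K,\pi)$ consists of a countable set $\mathcal X$, an irreducible stochastic matrix $K$ indexed by $\mathcal X$ and a stationary probability $\pi$ of $K$. Put $H_t=e^{-t(I-K)}=e^{-t}\sum_{m\ge 0}\frac{t^m}{m!}K^m$ and, for $t\ge 0$, $$d_{TV}(t)=\sup_{x\in\mathcal X,\,A\subset\mathcal X}\{H_t(x,A)-\pi(A)\},\qquad d_{H}(t)=\sup_{x\in\mathcal X}\Big(\tfrac12\sum_{y\in\mathcal X}\big(\sqrt{H_t(x,y)}-\sqrt{\pi(y)}\big)^2\Big)^{1/2},$$ and $T_*(\epsilon)=\inf\{t\ge 0: d_*(t)\le\epsilon\}$ for $*\in\{TV,H\}$. A family of continuous time chains $(\mathcal X_n,H_{n,t},\pi_n)_{n\ge1}$ with distances $d_{n,*}$ has a cutoff (in $*$) with cutoff time $t_n$ if $t_n>0$ for all $n$, $\lim_n d_{n,*}(at_n)=0$ for all $a>1$ and $\lim_n d_{n,*}(at_n)=1$ for all $a\in(0,1)$. Let $k_n$ be positive integers with $k_n\to\infty$. For $n\ge1$ and $1\le i\le k_n$ let $(\mathcal X_{n,i},K_{n,i},\pi_{n,i})$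 be a Markov chain with at least two states, with continuous time transition matrices $H_{n,i,t}$ and mixing times $T_{n,i,*}$, and let $p_{n,i}>0$. Put $q_n=p_{n,1}+\dots+p_{n,k_n}$ and let $\mathcal F^{\mathcal P}_c$ be the family of continuous time chains associated with the product chains on $\mathcal X_{n,1}\times\dots\times\mathcal X_{n,k_n}$ with transition matrix $\sum_{i=1}^{k_n}\frac{p_{n,i}}{q_n}\,I\otimes\dots\otimes I\otimes K_{n,i}\otimes I\otimes\dots\otimes I$ (with $K_{n,i}$ in the $i$-th factor) and stationary distribution $\pi_{n,1}\times\dots\times\pi_{n,k_n}$. Set $\varrho_{TV}=1$, $\varrho_H=2$, fix $*\in\{TV,H\}$ and let $\epsilon_{n,i}\in(0,1/(2\varrho_*))$ with $\inf_{n,i}\epsilon_{n,i}>0$. Write $T_{n,i}=T_{n,i,*}(\epsilon_{n,i})$ and assume that all $T_{n,i}$ are finite (which is automatic for finite state spaces). Define $$s_n=\max_{1\le i\le k_n}\frac{T_{n,i}}{p_{n,i}},\qquad R(c)=\lim_{m\to\infty}\limsup_{n\to\infty}\sum_{i=1}^{k_n-m}(2\varrho_*\epsilon_{n,i})^{c\varrho_*s_np_{n,i}/T_{n,i}}\in[0,\infty].$$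 **Theorem.** For each $*\in\{TV,H\}$, with cutoffs understood in $*$: (1) Let $t_{n,i}>0$ for $1\le i\le k_n$, $n\ge1$, and $t_n=\max_{1\le i\le k_n}t_{n,i}/p_{n,i}$. Suppose that $R(c)=0$ for all $c>1$ and that, for every $m\ge0$, the family $(\mathcal X_{n,k_n-m},H_{n,k_n-m,t},\pi_{n,k_n-m})_n$ (defined for all large $n$) has a cutoff with cutoff time $t_{n,k_n-m}$. Then $\mathcal F^{\mathcal P}_c$ has a cutoff with cutoff time $q_ns_n$, and $\limsup_n s_n/t_n\le1$. If moreover $\sup_{n,i}t_{n,i}/T_{n,i}<\infty$, then $s_n/t_n\to1$. (2) Suppose that $R(c)=0$ for some $c\in(0,1)$ and that $\mathcal F^{\mathcal P}_c$ has a cutoff with cutoff time $v_n$. Then there are positive integers $j_1<j_2<\cdots$ and $J_n$ with $1\le J_n\le k_{j_n}$ and $k_{j_n}-J_n=O(1)$ such that the family $(\mathcal X_{j_n,J_n},H_{j_n,J_n,t},\pi_{j_n,J_n})_{n\ge1}$ has a cutoff with cutoff time $p_{j_n,J_n}v_{j_n}/q_{j_n}$. -/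

import Mathlib

open Filter Topology

namespace ProductChain

noncomputable section

universe u v

/-- The identity matrix indexed by `X`. -/
def idKernel {X : Type u} (x y : X) : ℝ :=
  open Classical in if x = y then 1 else 0

/-- The powers `K ^ m` of a (possibly infinite) matrix indexed by `X`. -/
def kernelPow {X : Type u} (K : X → X → ℝ) : ℕ → X → X → ℝ
  | 0 => idKernel
  | m + 1 => fun x y => ∑' z, K x z * kernelPow K m z y

/-- `(X, K, π)` is an irreducible Markov chain: `K` is an irreducible stochastic matrix and
`π` is a probability on `X` which is stationary for `K`. -/
structure IsIrreducibleChain {X : Type u} (K : X → X → ℝ) (π : X → ℝ) : Prop where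
  nonneg : ∀ x y, 0 ≤ K x y
  hasSum_row : ∀ x, HasSum (K x) 1
  irreducible : ∀ x y, ∃ m : ℕ, 0 < kernelPow K m x y
  pi_nonneg : ∀ x, 0 ≤ π x
  hasSum_pi : HasSum π 1
  stationary : ∀ y, HasSum (fun x => π x * K x y) (π y)

/-- The transition matrix `H_t = e^{-t(I-K)} = e^{-t} ∑ₘ (t ^ m / m!) K ^ m` of the continuous time
chain associated with `K`, that is, of the chain `K` run at the jump times of an independent Poisson
process of rate one. -/
def heatKernel {X : Type u} (K : X → X → ℝ) (t : ℝ) (x y : X) : ℝ :=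
  Real.exp (-t) * ∑' m : ℕ, t ^ m / (m.factorial : ℝ) * kernelPow K m x y

/-- Total variation distance `sup_A (μ(A) - ν(A))`. -/
def tvDist {X : Type u} (μ ν : X → ℝ) : ℝ :=
  ⨆ A : Set X, ((∑' y : A, μ y) - (∑' y : A, ν y))

/-- Hellinger distance `(½ ∑_y (√μ(y) - √ν(y))²)^{1/2}`. -/
def hellingerDist {X : Type u} (μ ν : X → ℝ) : ℝ :=
  Real.sqrt ((1 / 2) * ∑' y, (Real.sqrt (μ y) - Real.sqrt (ν y)) ^ 2)

/-- The two distances under consideration: total variation and Hellinger. -/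
inductive DistKind where
  | TV : DistKind
  | H : DistKind

/-- The constant `ϱ`, equal to `1` for total variation and to `2` for Hellinger. -/
def rho : DistKind → ℝ
  | DistKind.TV => 1
  | DistKind.H => 2

/-- The distance between two probabilities on a countable set. -/
def probDist {X : Type u} : DistKind → (X → ℝ) → (X → ℝ) → ℝ
  | DistKind.TV => tvDist
  | DistKind.H => hellingerDist

/-- The maximum distance `d(t) = sup_x ‖H_t(x, ·) - π‖` of the continuous time chain. -/
def maxDist (D : DistKind) {X : Type u} (K : X → X → ℝ) (π : X → ℝ) (t : ℝ) : ℝ :=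
  ⨆ x : X, probDist D (heatKernel K t x) π

/-- The mixing time `T(ε) = inf {t ≥ 0 | d(t) ≤ ε}` of the continuous time chain. The value is
meaningful only when this set is non-empty, i.e. when the mixing time is finite. -/
def mixingTime (D : DistKind) {X : Type u} (K : X → X → ℝ) (π : X → ℝ) (ε : ℝ) : ℝ :=
  sInf {t : ℝ | 0 ≤ t ∧ maxDist D K π t ≤ ε}

/-- The mixing time at level `ε` is finite. -/
def MixingTimeFinite (D : DistKind) {X : Type u} (K : X → X → ℝ) (π : X → ℝ) (ε : ℝ) : Prop :=
  ∃ t : ℝ, 0 ≤ t ∧ maxDist D K π t ≤ ε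

/-- A family of continuous time chains with maximum distances `d n` has a cutoff with cutoff
time `t n`. -/
def HasCutoffAt (d : ℕ → ℝ → ℝ) (t : ℕ → ℝ) : Prop :=
  (∀ n, 0 < t n) ∧
  (∀ a : ℝ, 1 < a → Tendsto (fun n => d n (a * t n)) atTop (𝓝 0)) ∧
  (∀ a : ℝ, 0 < a → a < 1 → Tendsto (fun n => d n (a * t n)) atTop (𝓝 1))

/-- `∑ i, w i • (I ⊗ ⋯ ⊗ K i ⊗ ⋯ ⊗ I)`: the transition matrix of the product chain according to the
probability vector `w`. -/
def prodKernel {ι : Type v} [Fintype ι] [DecidableEq ι] {X : ι → Type u} (w : ι → ℝ)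
    (K : ∀ i, X i → X i → ℝ) (x y : ∀ i, X i) : ℝ :=
  ∑ i, w i * ∏ j, if j = i then K j (x j) (y j) else idKernel (x j) (y j)

/-- The product of the stationary distributions. -/
def prodPi {ι : Type v} [Fintype ι] {X : ι → Type u} (π : ∀ i, X i → ℝ) (x : ∀ i, X i) : ℝ :=
  ∏ i, π i (x i)

/-- The maximum distance of the continuous time chain associated with the product chain of
`(X i, K i, π i)`, `i < N`, according to the probability vector `p i / (∑ j, p j)`. -/
def prodMaxDist (D : DistKind) {N : ℕ} {X : Fin N → Type u} (p : Fin N → ℝ)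
    (K : ∀ i, X i → X i → ℝ) (π : ∀ i, X i → ℝ) (t : ℝ) : ℝ :=
  maxDist D (prodKernel (fun i => p i / ∑ j, p j) K) (prodPi π) t

/-- The `m`-th index counted from the end of `Fin N` (`m = 0` is the last one); it is the first
index if `m ≥ N`. -/
def fromEnd {N : ℕ} (hN : 0 < N) (m : ℕ) : Fin N :=
  ⟨N - 1 - m, by omega⟩

/-- `max_i a_i / p_i`. -/
def maxRatio {N : ℕ} (a p : Fin N → ℝ) : ℝ :=
  ⨆ i, a i / p i

/-- `∑_i (2ϱε_i)^{cϱ s p_i / T_i}`, where `s = max_i T_i / p_i` and the sum is over all but the last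
`m` indices of `Fin N`. -/
def tailSum (D : DistKind) {N : ℕ} (ε p T : Fin N → ℝ) (c : ℝ) (m : ℕ) : ℝ :=
  ∑ i with i.val + m < N, (2 * rho D * ε i) ^ (c * rho D * maxRatio T p * p i / T i)

/-- `R(c) = 0`, where `R(c) = lim_{m → ∞} limsup_{n → ∞} tailSum`, a limit in `[0, ∞]`. -/
def TailVanishes (D : DistKind) {k : ℕ → ℕ} (ε p T : ∀ n, Fin (k n) → ℝ) (c : ℝ) : Prop :=
  Tendsto (fun m : ℕ =>
      limsup (fun n : ℕ => ENNReal.ofReal (tailSum D (ε n) (p n) (T n) c m)) atTop)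
    atTop (𝓝 0)

end

end ProductChain

open ProductChain

namespace ProductChain

universe u v

/-! For both distances, one minus the `ϱ`-th power of the distance is an affinity: the sum over the
state space of the minimum, respectively the geometric mean, of the two masses. These two functions
are homogeneous, superadditive, and supermultiplicative over products, and this is nearly all that
distinguishes the distances from others.

Superadditivity makes the distance decrease under kernels (`affinity_le_affinity_push`); hence
`d(t)` is nonincreasing, and by projection each coordinate is at most as far from equilibrium as the
product. Supermultiplicativity gives the opposite estimate `P ^ ϱ ≤ 1 - ∏ (1 - d_i ^ ϱ)`
(`prodMaxDist_rpow_le`). Both apply because the product chain at time `q t` runs its coordinates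
independently up to the times `p_i t` (`heatKernel_prodKernel`): its generator is a sum of commuting
operators, and the exponential factorises on `ℓ¹`.

The other ingredient is `d(s + t) ≤ 2ϱ d(s) d(t)` (`maxDist_add_le`), whence `d(t) ≤ (2ϱε) ^ (t / T
- 1)` (`maxDist_le_rpow`). So at a time at least `c s` the coordinates outside the last `m`
contribute at most a constant times the tail sum of `R(c)`. If `R(c) = 0`, only boundedly many
coordinates matter, and any index with `s p_i / T_i` bounded, in particular a maximizer of `T_i /
p_i`, is eventually among them (`exists_eventually_last`).

In part (1) the product mixes once these last coordinates have mixed, which their cutoffs bring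
about just after `s`, and before `s` the maximizer alone keeps it away from equilibrium. In part
(2), if all the last coordinates had distance at most `1 - η` shortly before the cutoff, the product
bound would keep `P` away from `1`; so one of them is nearly singular to equilibrium, and a diagonal
extraction turns this into a cutoff. -/

/-! ### Probabilities and stochastic kernels on a discrete space -/

/-- `μ` is a probability mass function. -/
structure IsProb {X : Type u} (μ : X → ℝ) : Prop where
  nonneg : ∀ x, 0 ≤ μ x
  hasSum : HasSum μ 1

/-- The image `μ P` of the mass function `μ` under the kernel `P`. -/
noncomputable def push {X : Type u} {Y : Type v} (μ : X → ℝ) (P : X → Y → ℝ) (y : Y) : ℝ :=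
  ∑' x, μ x * P x y

theorem hasSum_of_forall_eq {X : Type u} {f g : X → ℝ} {a : ℝ} (h : HasSum f a)
    (e : ∀ x, g x = f x) : HasSum g a := by
  rwa [funext e]

theorem hasSum_swap {X : Type u} {Y : Type v} {f : X → Y → ℝ} {g : X → ℝ} {G : ℝ}
    (hf : ∀ x y, 0 ≤ f x y) (hrow : ∀ x, HasSum (f x) (g x)) (hg : HasSum g G) :
    (∀ y, Summable fun x => f x y) ∧ HasSum (fun y => ∑' x, f x y) G := by
  have hs : Summable (fun z : X × Y => f z.1 z.2) := by
    rw [summable_prod_of_nonneg (fun z => hf z.1 z.2)]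
    exact ⟨fun x => (hrow x).summable, by simpa [(hrow _).tsum_eq] using hg.summable⟩
  have hs' : Summable (fun z : Y × X => f z.2 z.1) := hs.prod_symm
  refine ⟨fun y => hs'.prod_factor y, ?_⟩
  have h1 : Summable (fun y => ∑' x, f x y) := hs'.prod
  have h2 : ∑' y, ∑' x, f x y = G := by
    have h3 := Summable.tsum_comm (f := f) hs
    rw [h3]
    simp_rw [(hrow _).tsum_eq]
    exact hg.tsum_eq
  exact h2 ▸ h1.hasSum

theorem IsProb.le_one {X : Type u} {μ : X → ℝ} (h : IsProb μ) (x : X) : μ x ≤ 1 :=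
  le_hasSum h.hasSum x fun y _ => h.nonneg y

theorem IsProb.summable_mul {X : Type u} {Y : Type v} {μ : X → ℝ} (h : IsProb μ) {P : X → Y → ℝ}
    (hP : ∀ x, IsProb (P x)) (y : Y) : Summable fun x => μ x * P x y :=
  Summable.of_nonneg_of_le (fun x => mul_nonneg (h.nonneg x) ((hP x).nonneg y))
    (fun x => mul_le_of_le_one_right (h.nonneg x) ((hP x).le_one y)) h.hasSum.summable

theorem IsProb.push {X : Type u} {Y : Type v} {μ : X → ℝ} (h : IsProb μ) {P : X → Y → ℝ}
    (hP : ∀ x, IsProb (P x)) : IsProb (push μ P) where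
  nonneg y := tsum_nonneg fun x => mul_nonneg (h.nonneg x) ((hP x).nonneg y)
  hasSum := (hasSum_swap (f := fun x y => μ x * P x y) (g := μ)
    (fun x y => mul_nonneg (h.nonneg x) ((hP x).nonneg y))
    (fun x => by simpa using (hP x).hasSum.mul_left (μ x)) h.hasSum).2

theorem isProb_idKernel {X : Type u} (x : X) : IsProb (idKernel x) where
  nonneg y := by unfold idKernel; split_ifs <;> norm_num
  hasSum := by
    classical
    have := hasSum_single (f := idKernel x) x (fun y hy => by simp [idKernel, hy.symm])
    simpa [idKernel] using this

theorem sum_mul_idKernel {X : Type u} (f : X → ℝ) (y : X) : ∑' x, f x * idKernel x y = f y := by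
  rw [tsum_eq_single y]
  · simp [idKernel]
  · intro x hx; simp [idKernel, hx]

theorem sum_idKernel_mul {X : Type u} (f : X → ℝ) (x : X) : ∑' y, idKernel x y * f y = f x := by
  rw [tsum_eq_single x]
  · simp [idKernel]
  · intro y hy; simp [idKernel, hy.symm]

/-! ### The overlap of two mass functions -/

/-- The pointwise overlap: the minimum for total variation, the geometric mean for Hellinger. -/
noncomputable def overlap : DistKind → ℝ → ℝ → ℝ
  | DistKind.TV, a, b => min a b
  | DistKind.H, a, b => √a * √b

theorem overlap_nonneg (D : DistKind) {a b : ℝ} (ha : 0 ≤ a) (hb : 0 ≤ b) :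
    0 ≤ overlap D a b := by
  cases D
  · exact le_min ha hb
  · exact mul_nonneg (Real.sqrt_nonneg _) (Real.sqrt_nonneg _)

theorem overlap_le_add (D : DistKind) {a b : ℝ} (ha : 0 ≤ a) (hb : 0 ≤ b) :
    overlap D a b ≤ a + b := by
  cases D
  · exact (min_le_left a b).trans (by linarith)
  · simp only [overlap]
    nlinarith [Real.sq_sqrt ha, Real.sq_sqrt hb, sq_nonneg (√a - √b), Real.sqrt_nonneg a,
      Real.sqrt_nonneg b]

theorem overlap_mul_const (D : DistKind) {a b c : ℝ} (hc : 0 ≤ c) :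
    overlap D (a * c) (b * c) = overlap D a b * c := by
  cases D
  · simp only [overlap]
    rw [min_mul_of_nonneg _ _ hc]
  · simp only [overlap]
    rw [Real.sqrt_mul' _ hc, Real.sqrt_mul' _ hc]
    linear_combination √a * √b * Real.mul_self_sqrt hc

theorem prod_overlap_le (D : DistKind) {ι : Type v} (s : Finset ι) (a b : ι → ℝ)
    (ha : ∀ i, 0 ≤ a i) (hb : ∀ i, 0 ≤ b i) :
    ∏ i ∈ s, overlap D (a i) (b i) ≤ overlap D (∏ i ∈ s, a i) (∏ i ∈ s, b i) := by
  cases D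
  · exact le_min (Finset.prod_le_prod (fun i _ => le_min (ha i) (hb i)) fun i _ => min_le_left _ _)
      (Finset.prod_le_prod (fun i _ => le_min (ha i) (hb i)) fun i _ => min_le_right _ _)
  · simp only [overlap, Finset.prod_mul_distrib]
    rw [Real.sqrt_prod _ fun i _ => ha i, Real.sqrt_prod _ fun i _ => hb i]

theorem tsum_sqrt_mul_sqrt_le {X : Type u} {f g : X → ℝ} (hf : ∀ x, 0 ≤ f x) (hg : ∀ x, 0 ≤ g x)
    (hfs : Summable f) (hgs : Summable g) :
    Summable (fun x => √(f x) * √(g x)) ∧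
      ∑' x, √(f x) * √(g x) ≤ √(∑' x, f x) * √(∑' x, g x) := by
  have := Real.summable_and_inner_le_Lp_mul_Lq_tsum_of_nonneg (p := 2) (q := 2)
    Real.HolderConjugate.two_two (f := fun x => √(f x)) (g := fun x => √(g x))
    (fun x => Real.sqrt_nonneg _) (fun x => Real.sqrt_nonneg _)
    (by simpa [Real.sq_sqrt (hf _)] using hfs) (by simpa [Real.sq_sqrt (hg _)] using hgs)
  refine ⟨this.1, this.2.trans_eq ?_⟩
  simp only [Real.rpow_two, Real.sq_sqrt (hf _), Real.sq_sqrt (hg _)]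
  rw [Real.sqrt_eq_rpow, Real.sqrt_eq_rpow]

theorem summable_overlap (D : DistKind) {X : Type u} {f g : X → ℝ} (hf : ∀ x, 0 ≤ f x)
    (hg : ∀ x, 0 ≤ g x) (hfs : Summable f) (hgs : Summable g) :
    Summable fun x => overlap D (f x) (g x) :=
  Summable.of_nonneg_of_le (fun x => overlap_nonneg D (hf x) (hg x))
    (fun x => overlap_le_add D (hf x) (hg x)) (hfs.add hgs)

/-- Superadditivity of the overlap is termwise for the minimum and is the Cauchy–Schwarz inequality
for the geometric mean. -/
theorem tsum_overlap_le (D : DistKind) {X : Type u} {f g : X → ℝ} (hf : ∀ x, 0 ≤ f x)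
    (hg : ∀ x, 0 ≤ g x) (hfs : Summable f) (hgs : Summable g) :
    ∑' x, overlap D (f x) (g x) ≤ overlap D (∑' x, f x) (∑' x, g x) := by
  have hs := summable_overlap D hf hg hfs hgs
  cases D
  · exact le_min (hs.tsum_le_tsum (fun x => min_le_left _ _) hfs)
      (hs.tsum_le_tsum (fun x => min_le_right _ _) hgs)
  · exact (tsum_sqrt_mul_sqrt_le hf hg hfs hgs).2

/-- The affinity `∑ overlap` of two mass functions, equal to one minus the `ϱ`-th power of their
distance. -/
noncomputable def affinity (D : DistKind) {X : Type u} (μ ν : X → ℝ) : ℝ :=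
  ∑' x, overlap D (μ x) (ν x)

theorem affinity_nonneg (D : DistKind) {X : Type u} {μ ν : X → ℝ} (hμ : IsProb μ) (hν : IsProb ν) :
    0 ≤ affinity D μ ν :=
  tsum_nonneg fun x => overlap_nonneg D (hμ.nonneg x) (hν.nonneg x)

theorem affinity_le_one (D : DistKind) {X : Type u} {μ ν : X → ℝ} (hμ : IsProb μ) (hν : IsProb ν) :
    affinity D μ ν ≤ 1 := by
  refine (tsum_overlap_le D hμ.nonneg hν.nonneg hμ.hasSum.summable hν.hasSum.summable).trans ?_
  rw [hμ.hasSum.tsum_eq, hν.hasSum.tsum_eq]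
  cases D <;> simp [overlap]

/-- Splitting the mass at `x` into the pieces `μ x * P x y` preserves the total overlap by
homogeneity; merging the pieces that arrive at the same `y` can only increase it. -/
theorem affinity_le_affinity_push (D : DistKind) {X : Type u} {Y : Type v} {μ ν : X → ℝ}
    (hμ : IsProb μ) (hν : IsProb ν) {P : X → Y → ℝ} (hP : ∀ x, IsProb (P x)) :
    affinity D μ ν ≤ affinity D (push μ P) (push ν P) := by
  have hs := summable_overlap D hμ.nonneg hν.nonneg hμ.hasSum.summable hν.hasSum.summable
  obtain ⟨h1, h2⟩ := hasSum_swap (f := fun x y => overlap D (μ x) (ν x) * P x y)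
    (g := fun x => overlap D (μ x) (ν x))
    (fun x y => mul_nonneg (overlap_nonneg D (hμ.nonneg x) (hν.nonneg x)) ((hP x).nonneg y))
    (fun x => by simpa using (hP x).hasSum.mul_left (overlap D (μ x) (ν x))) hs.hasSum
  rw [affinity, ← h2.tsum_eq]
  refine h2.summable.tsum_le_tsum (fun y => ?_) (summable_overlap D (hμ.push hP).nonneg
    (hν.push hP).nonneg (hμ.push hP).hasSum.summable (hν.push hP).hasSum.summable)
  have := tsum_overlap_le D (fun x => mul_nonneg (hμ.nonneg x) ((hP x).nonneg y))
    (fun x => mul_nonneg (hν.nonneg x) ((hP x).nonneg y)) (hμ.summable_mul hP y)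
    (hν.summable_mul hP y)
  simp_rw [overlap_mul_const D ((hP _).nonneg y)] at this
  exact this

/-! ### The two distances as functions of the affinity -/

theorem tvDist_eq {X : Type u} {μ ν : X → ℝ} (hμ : IsProb μ) (hν : IsProb ν) :
    tvDist μ ν = 1 - affinity DistKind.TV μ ν := by
  have hs := summable_overlap DistKind.TV hμ.nonneg hν.nonneg hμ.hasSum.summable
    hν.hasSum.summable
  have hd : HasSum (fun x => μ x - overlap DistKind.TV (μ x) (ν x))
      (1 - affinity DistKind.TV μ ν) := hμ.hasSum.sub hs.hasSum
  have key : ∀ A : Set X, (∑' y : A, μ y) - (∑' y : A, ν y)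
      = ∑' y, A.indicator (fun y => μ y - ν y) y := by
    intro A
    exact (Summable.tsum_sub (hμ.hasSum.summable.subtype A) (hν.hasSum.summable.subtype A)).symm.trans
      (tsum_subtype A fun y => μ y - ν y)
  have hsub : Summable fun y => μ y - ν y := hμ.hasSum.summable.sub hν.hasSum.summable
  have hle : ∀ A : Set X, (∑' y : A, μ y) - (∑' y : A, ν y) ≤ 1 - affinity DistKind.TV μ ν := by
    intro A
    rw [key, ← hd.tsum_eq]
    refine (hsub.indicator A).tsum_le_tsum (fun y => ?_) hd.summable
    by_cases hy : y ∈ A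
    · simp only [Set.indicator_of_mem hy, overlap]
      linarith [min_le_right (μ y) (ν y)]
    · simp only [Set.indicator_of_notMem hy, overlap]
      linarith [min_le_left (μ y) (ν y)]
  refine le_antisymm (ciSup_le hle) ?_
  -- The supremum is attained at the set where `ν ≤ μ`, on which `μ - ν` equals `μ - min μ ν`.
  refine le_ciSup_of_le ⟨_, Set.forall_mem_range.2 hle⟩ {y | ν y ≤ μ y} ?_
  rw [key, ← hd.tsum_eq]
  refine (tsum_congr fun y => ?_).le
  by_cases hy : ν y ≤ μ y
  · simp [overlap, hy]
  · simp [overlap, hy, (not_le.1 hy).le]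

theorem hasSum_sq_sqrt_sub_sqrt {X : Type u} {μ ν : X → ℝ} (hμ : IsProb μ) (hν : IsProb ν) :
    HasSum (fun x => (√(μ x) - √(ν x)) ^ 2) (2 * (1 - affinity DistKind.H μ ν)) := by
  have hs := summable_overlap DistKind.H hμ.nonneg hν.nonneg hμ.hasSum.summable
    hν.hasSum.summable
  have := (hμ.hasSum.add hν.hasSum).sub (hs.hasSum.mul_left 2)
  have hv : 2 * (1 - affinity DistKind.H μ ν)
      = 1 + 1 - 2 * ∑' x, overlap DistKind.H (μ x) (ν x) := by
    simp only [affinity]; ring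
  rw [hv]
  refine hasSum_of_forall_eq this fun x => ?_
  simp only [overlap]
  linear_combination Real.sq_sqrt (hμ.nonneg x) + Real.sq_sqrt (hν.nonneg x)

theorem hasSum_abs_sub {X : Type u} {μ ν : X → ℝ} (hμ : IsProb μ) (hν : IsProb ν) :
    HasSum (fun x => |μ x - ν x|) (2 * (1 - affinity DistKind.TV μ ν)) := by
  have hs := summable_overlap DistKind.TV hμ.nonneg hν.nonneg hμ.hasSum.summable
    hν.hasSum.summable
  have := (hμ.hasSum.add hν.hasSum).sub (hs.hasSum.mul_left 2)
  have hv : 2 * (1 - affinity DistKind.TV μ ν)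
      = 1 + 1 - 2 * ∑' x, overlap DistKind.TV (μ x) (ν x) := by
    simp only [affinity]; ring
  rw [hv]
  refine hasSum_of_forall_eq this fun x => ?_
  simp only [overlap]
  rcases le_total (μ x) (ν x) with h | h
  · rw [min_eq_left h, abs_of_nonpos (by linarith)]; ring
  · rw [min_eq_right h, abs_of_nonneg (by linarith)]; ring

theorem hellingerDist_sq {X : Type u} {μ ν : X → ℝ} (hμ : IsProb μ) (hν : IsProb ν) :
    hellingerDist μ ν ^ 2 = 1 - affinity DistKind.H μ ν := by
  rw [hellingerDist, (hasSum_sq_sqrt_sub_sqrt hμ hν).tsum_eq, Real.sq_sqrt]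
  · ring
  · linarith [affinity_le_one DistKind.H hμ hν]

theorem probDist_nonneg (D : DistKind) {X : Type u} {μ ν : X → ℝ} (hμ : IsProb μ)
    (hν : IsProb ν) : 0 ≤ probDist D μ ν := by
  cases D
  · simp only [probDist]
    rw [tvDist_eq hμ hν]
    linarith [affinity_le_one DistKind.TV hμ hν]
  · exact Real.sqrt_nonneg _

theorem rho_pos (D : DistKind) : 0 < rho D := by
  cases D <;> norm_num [rho]

theorem probDist_rpow_rho (D : DistKind) {X : Type u} {μ ν : X → ℝ} (hμ : IsProb μ)
    (hν : IsProb ν) : probDist D μ ν ^ rho D = 1 - affinity D μ ν := by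
  cases D
  · simpa [probDist, rho] using tvDist_eq hμ hν
  · simpa [probDist, rho] using hellingerDist_sq hμ hν

theorem probDist_le_one (D : DistKind) {X : Type u} {μ ν : X → ℝ} (hμ : IsProb μ)
    (hν : IsProb ν) : probDist D μ ν ≤ 1 := by
  rw [← Real.rpow_le_rpow_iff (probDist_nonneg D hμ hν) zero_le_one (rho_pos D),
    probDist_rpow_rho D hμ hν, Real.one_rpow]
  linarith [affinity_nonneg D hμ hν]

theorem probDist_le_iff_affinity_le (D : DistKind) {X : Type u} {Y : Type v} {μ ν : X → ℝ}
    {μ' ν' : Y → ℝ} (hμ : IsProb μ) (hν : IsProb ν) (hμ' : IsProb μ') (hν' : IsProb ν') :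
    probDist D μ ν ≤ probDist D μ' ν' ↔ affinity D μ' ν' ≤ affinity D μ ν := by
  rw [← Real.rpow_le_rpow_iff (probDist_nonneg D hμ hν) (probDist_nonneg D hμ' hν') (rho_pos D),
    probDist_rpow_rho D hμ hν, probDist_rpow_rho D hμ' hν']
  constructor <;> intro h <;> linarith

theorem probDist_push_le (D : DistKind) {X : Type u} {Y : Type v} {μ ν : X → ℝ}
    (hμ : IsProb μ) (hν : IsProb ν) {P : X → Y → ℝ} (hP : ∀ x, IsProb (P x)) :
    probDist D (push μ P) (push ν P) ≤ probDist D μ ν :=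
  (probDist_le_iff_affinity_le D (hμ.push hP) (hν.push hP) hμ hν).2
    (affinity_le_affinity_push D hμ hν hP)

/-! ### Submultiplicativity of the distance to stationarity -/

/-- Subtracting `π y` from each `P x y` costs nothing, since `μ - π` has total mass zero. The
product of two deviations is what makes the distance submultiplicative. -/
theorem hasSum_sub_mul_sub {X : Type u} {μ π : X → ℝ} (hμ : IsProb μ) (hπ : IsProb π)
    {P : X → X → ℝ} (hP : ∀ x, IsProb (P x)) (hst : push π P = π) (y : X) :
    HasSum (fun x => (μ x - π x) * (P x y - π y)) (push μ P y - π y) := by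
  have h1 := (hμ.summable_mul hP y).hasSum.sub (hπ.summable_mul hP y).hasSum
  have h2 := (hμ.hasSum.sub hπ.hasSum).mul_right (π y)
  have h3 := h1.sub h2
  have hv : push μ P y - π y
      = (∑' x, μ x * P x y - ∑' x, π x * P x y) - (1 - 1) * π y := by
    have : ∑' x, π x * P x y = π y := congrFun hst y
    rw [this]; simp [push]
  rw [hv]
  refine hasSum_of_forall_eq h3 fun x => ?_
  ring

/-- Twice the total variation distance is the `ℓ¹` norm of the difference, so the triangle
inequality in `hasSum_sub_mul_sub`, summed over `y`, gives the factor `2 * 2 / 2`. -/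
theorem tvDist_push_le {X : Type u} {μ π : X → ℝ} (hμ : IsProb μ) (hπ : IsProb π)
    {P : X → X → ℝ} (hP : ∀ x, IsProb (P x)) (hst : push π P = π) {δ : ℝ}
    (hδ : ∀ x, tvDist (P x) π ≤ δ) :
    tvDist (push μ P) π ≤ 2 * tvDist μ π * δ := by
  have hd : ∀ x, HasSum (fun y => |μ x - π x| * |P x y - π y|)
      (|μ x - π x| * (2 * tvDist (P x) π)) := fun x => by
    rw [tvDist_eq (hP x) hπ]
    exact (hasSum_abs_sub (hP x) hπ).mul_left _
  have hle : ∀ x, |μ x - π x| * (2 * tvDist (P x) π) ≤ |μ x - π x| * (2 * δ) := fun x =>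
    mul_le_mul_of_nonneg_left (by linarith [hδ x]) (abs_nonneg _)
  have hm : HasSum (fun x => |μ x - π x| * (2 * δ)) (2 * tvDist μ π * (2 * δ)) := by
    rw [tvDist_eq hμ hπ]
    exact (hasSum_abs_sub hμ hπ).mul_right _
  have hg : Summable fun x => |μ x - π x| * (2 * tvDist (P x) π) :=
    Summable.of_nonneg_of_le (fun x => mul_nonneg (abs_nonneg _)
      (mul_nonneg zero_le_two (probDist_nonneg DistKind.TV (hP x) hπ))) hle hm.summable
  obtain ⟨h1, h2⟩ := hasSum_swap (f := fun x y => |μ x - π x| * |P x y - π y|)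
    (fun x y => by positivity) hd hg.hasSum
  have h3 := hasSum_abs_sub (hμ.push hP) hπ
  rw [← tvDist_eq (hμ.push hP) hπ] at h3
  have h4 := hasSum_le (fun y => ?_) h3 h2
  · have h5 := hasSum_le hle hg.hasSum hm
    linarith
  · rw [← (hasSum_sub_mul_sub hμ hπ hP hst y).tsum_eq]
    have := norm_tsum_le_tsum_norm (f := fun x => (μ x - π x) * (P x y - π y))
      (by simpa [abs_mul] using h1 y)
    simpa [abs_mul] using this

/-- This is the second factor of the Cauchy–Schwarz inequality in `sq_sqrt_push_sub_le`. With `a =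
√(push μ P y)` and `b = √(π y)`, expanding the squares and bounding each cross term by
Cauchy–Schwarz gives `a ^ 2 + 8 a b + 7 b ^ 2`, which is at most `7 (a + b) ^ 2`. -/
theorem summable_and_tsum_sq_mul_sq_le {X : Type u} {μ π : X → ℝ} (hμ : IsProb μ)
    (hπ : IsProb π) {P : X → X → ℝ} (hP : ∀ x, IsProb (P x)) (hst : push π P = π) (y : X) :
    Summable (fun x => (√(μ x) + √(π x)) ^ 2 * (√(P x y) + √(π y)) ^ 2) ∧
    ∑' x, (√(μ x) + √(π x)) ^ 2 * (√(P x y) + √(π y)) ^ 2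
      ≤ 7 * (√(push μ P y) + √(π y)) ^ 2 := by
  have hB : ∑' x, π x * P x y = π y := congrFun hst y
  have hA : ∑' x, μ x * P x y = push μ P y := rfl
  have sA := hμ.summable_mul hP y
  have sB := hπ.summable_mul hP y
  have nA : ∀ x, 0 ≤ μ x * P x y := fun x => mul_nonneg (hμ.nonneg x) ((hP x).nonneg y)
  have nB : ∀ x, 0 ≤ π x * P x y := fun x => mul_nonneg (hπ.nonneg x) ((hP x).nonneg y)
  have sμ := hμ.hasSum.summable
  have sπ := hπ.hasSum.summable
  obtain ⟨s1, l1⟩ := tsum_sqrt_mul_sqrt_le nA nB sA sB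
  obtain ⟨s2, l2⟩ := tsum_sqrt_mul_sqrt_le hμ.nonneg hπ.nonneg sμ sπ
  obtain ⟨s3, l3⟩ := tsum_sqrt_mul_sqrt_le hμ.nonneg nA sμ sA
  obtain ⟨s4, l4⟩ := tsum_sqrt_mul_sqrt_le hπ.nonneg nB sπ sB
  obtain ⟨s5, l5⟩ := tsum_sqrt_mul_sqrt_le hπ.nonneg nA sπ sA
  rw [hA, hB] at l1
  rw [hμ.hasSum.tsum_eq, hπ.hasSum.tsum_eq] at l2
  rw [hμ.hasSum.tsum_eq, hA] at l3
  rw [hπ.hasSum.tsum_eq, hB] at l4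
  rw [hπ.hasSum.tsum_eq, hA] at l5
  have hsum := ((sA.hasSum.add sB.hasSum).add (s1.hasSum.mul_left 2)).add
    ((((hμ.hasSum.add hπ.hasSum).add (s2.hasSum.mul_left 2)).mul_left (π y)).add
      (((s3.hasSum.add s4.hasSum).add (s5.hasSum.mul_left 2)).mul_left (2 * √(π y))))
  have heq : (fun x => (√(μ x) + √(π x)) ^ 2 * (√(P x y) + √(π y)) ^ 2) = fun x =>
      ((μ x * P x y + π x * P x y) + 2 * (√(μ x * P x y) * √(π x * P x y))) +
      (π y * ((μ x + π x) + 2 * (√(μ x) * √(π x))) +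
      2 * √(π y) * ((√(μ x) * √(μ x * P x y) + √(π x) * √(π x * P x y))
        + 2 * (√(π x) * √(μ x * P x y)))) := by
    ext x
    rw [Real.sqrt_mul (hμ.nonneg x), Real.sqrt_mul (hπ.nonneg x)]
    have e1 := Real.sq_sqrt (hμ.nonneg x)
    have e2 := Real.sq_sqrt (hπ.nonneg x)
    have e3 := Real.sq_sqrt ((hP x).nonneg y)
    have e4 := Real.sq_sqrt (hπ.nonneg y)
    generalize √(μ x) = a at *
    generalize √(π x) = b at *
    generalize √(P x y) = c at *
    generalize √(π y) = e at *
    rw [← e1, ← e2, ← e3, ← e4]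
    ring
  rw [heq]
  refine ⟨hsum.summable, ?_⟩
  rw [hsum.tsum_eq, hA, hB]
  have qA := Real.sq_sqrt ((hμ.push hP).nonneg y)
  have qB := Real.sq_sqrt (hπ.nonneg y)
  have pA := Real.sqrt_nonneg (push μ P y)
  have pB := Real.sqrt_nonneg (π y)
  simp only [Real.sqrt_one, one_mul] at l2 l3 l4 l5
  generalize √(push μ P y) = a at *
  generalize √(π y) = b at *
  rw [← qA, ← qB]
  have m2 := mul_le_mul_of_nonneg_left l2 (sq_nonneg b)
  have m3 := mul_le_mul_of_nonneg_left l3 pB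
  have m4 := mul_le_mul_of_nonneg_left l4 pB
  have m5 := mul_le_mul_of_nonneg_left l5 pB
  nlinarith [mul_nonneg pA pB, sq_nonneg a]

/-- Each deviation is a difference of squares, `μ - π = (√μ - √π)(√μ + √π)`. Cauchy–Schwarz
separates the differences from the sums, and the factor `(√(push μ P y) + √(π y)) ^ 2` then cancels
on both sides. -/
theorem sq_sqrt_push_sub_le {X : Type u} {μ π : X → ℝ} (hμ : IsProb μ)
    (hπ : IsProb π) {P : X → X → ℝ} (hP : ∀ x, IsProb (P x)) (hst : push π P = π) (y : X)
    (hs : Summable fun x => (√(μ x) - √(π x)) ^ 2 * (√(P x y) - √(π y)) ^ 2) :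
    (√(push μ P y) - √(π y)) ^ 2
      ≤ 7 * ∑' x, (√(μ x) - √(π x)) ^ 2 * (√(P x y) - √(π y)) ^ 2 := by
  obtain ⟨sW, lW⟩ := summable_and_tsum_sq_mul_sq_le hμ hπ hP hst y
  obtain ⟨sC, lC⟩ := tsum_sqrt_mul_sqrt_le (fun x => by positivity) (fun x => by positivity) hs sW
  set S := ∑' x, (√(μ x) - √(π x)) ^ 2 * (√(P x y) - √(π y)) ^ 2
  set W := ∑' x, (√(μ x) + √(π x)) ^ 2 * (√(P x y) + √(π y)) ^ 2
  have hS : 0 ≤ S := tsum_nonneg fun x => by positivity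
  have hW : 0 ≤ W := tsum_nonneg fun x => by positivity
  have heq : ∀ x, √((√(μ x) - √(π x)) ^ 2 * (√(P x y) - √(π y)) ^ 2) *
      √((√(μ x) + √(π x)) ^ 2 * (√(P x y) + √(π y)) ^ 2)
      = ‖(μ x - π x) * (P x y - π y)‖ := by
    intro x
    rw [← Real.sqrt_mul (by positivity), Real.norm_eq_abs, ← Real.sqrt_sq_eq_abs]
    congr 1
    have e1 := Real.sq_sqrt (hμ.nonneg x)
    have e2 := Real.sq_sqrt (hπ.nonneg x)
    have e3 := Real.sq_sqrt ((hP x).nonneg y)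
    have e4 := Real.sq_sqrt (hπ.nonneg y)
    generalize √(μ x) = a at *
    generalize √(π x) = b at *
    generalize √(P x y) = c at *
    generalize √(π y) = e at *
    rw [← e1, ← e2, ← e3, ← e4]
    ring
  simp_rw [heq] at sC lC
  have h1 := norm_tsum_le_tsum_norm sC
  rw [(hasSum_sub_mul_sub hμ hπ hP hst y).tsum_eq, Real.norm_eq_abs] at h1
  have h2 : (push μ P y - π y) ^ 2 ≤ S * W := by
    have h3 := pow_le_pow_left₀ (abs_nonneg _) (h1.trans lC) 2
    rwa [sq_abs, mul_pow, Real.sq_sqrt hS, Real.sq_sqrt hW] at h3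
  have qA := Real.sq_sqrt ((hμ.push hP).nonneg y)
  have qB := Real.sq_sqrt (hπ.nonneg y)
  have pA := Real.sqrt_nonneg (push μ P y)
  have pB := Real.sqrt_nonneg (π y)
  generalize √(push μ P y) = a at *
  generalize √(π y) = b at *
  rw [← qA, ← qB] at h2
  rcases eq_or_lt_of_le (add_nonneg pA pB) with h0 | h0
  · have ha : a = 0 := by linarith
    have hb : b = 0 := by linarith
    rw [ha, hb]; simpa using hS
  · have h4 : (a - b) ^ 2 * (a + b) ^ 2 ≤ 7 * S * (a + b) ^ 2 :=
      calc (a - b) ^ 2 * (a + b) ^ 2 = (a ^ 2 - b ^ 2) ^ 2 := by ring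
        _ ≤ S * W := h2
        _ ≤ S * (7 * (a + b) ^ 2) := mul_le_mul_of_nonneg_left lW hS
        _ = 7 * S * (a + b) ^ 2 := by ring
    exact le_of_mul_le_mul_right h4 (by positivity)

theorem hellingerDist_push_le {X : Type u} {μ π : X → ℝ} (hμ : IsProb μ) (hπ : IsProb π)
    {P : X → X → ℝ} (hP : ∀ x, IsProb (P x)) (hst : push π P = π) {δ : ℝ} (hδ0 : 0 ≤ δ)
    (hδ : ∀ x, hellingerDist (P x) π ≤ δ) :
    hellingerDist (push μ P) π ≤ 4 * hellingerDist μ π * δ := by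
  have hd : ∀ x, HasSum (fun y => (√(μ x) - √(π x)) ^ 2 * (√(P x y) - √(π y)) ^ 2)
      ((√(μ x) - √(π x)) ^ 2 * (2 * hellingerDist (P x) π ^ 2)) := fun x => by
    rw [hellingerDist_sq (hP x) hπ]
    exact (hasSum_sq_sqrt_sub_sqrt (hP x) hπ).mul_left _
  have hle : ∀ x, (√(μ x) - √(π x)) ^ 2 * (2 * hellingerDist (P x) π ^ 2)
      ≤ (√(μ x) - √(π x)) ^ 2 * (2 * δ ^ 2) := fun x => by
    gcongr
    exacts [Real.sqrt_nonneg _, hδ x]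
  have hm : HasSum (fun x => (√(μ x) - √(π x)) ^ 2 * (2 * δ ^ 2))
      (2 * hellingerDist μ π ^ 2 * (2 * δ ^ 2)) := by
    rw [hellingerDist_sq hμ hπ]
    exact (hasSum_sq_sqrt_sub_sqrt hμ hπ).mul_right _
  have hg : Summable fun x => (√(μ x) - √(π x)) ^ 2 * (2 * hellingerDist (P x) π ^ 2) :=
    Summable.of_nonneg_of_le (fun x => by positivity) hle hm.summable
  obtain ⟨h1, h2⟩ := hasSum_swap (f := fun x y => (√(μ x) - √(π x)) ^ 2 * (√(P x y) - √(π y)) ^ 2)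
    (fun x y => by positivity) hd hg.hasSum
  have h3 := hasSum_sq_sqrt_sub_sqrt (hμ.push hP) hπ
  rw [← hellingerDist_sq (hμ.push hP) hπ] at h3
  have h4 := hasSum_le (fun y => sq_sqrt_push_sub_le hμ hπ hP hst y (h1 y)) h3 (h2.mul_left 7)
  have h5 := hasSum_le hle hg.hasSum hm
  have h6 : 0 ≤ hellingerDist μ π := Real.sqrt_nonneg _
  -- Summing over `y` gives the squared constant `7 * 2 * 2 / 2 = 14`, which is below `4 ^ 2`.
  refine le_of_sq_le_sq ?_ (by positivity)
  nlinarith [mul_nonneg (sq_nonneg (hellingerDist μ π)) (sq_nonneg δ)]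

theorem probDist_push_le_mul (D : DistKind) {X : Type u} {μ π : X → ℝ} (hμ : IsProb μ)
    (hπ : IsProb π) {P : X → X → ℝ} (hP : ∀ x, IsProb (P x)) (hst : push π P = π) {δ : ℝ}
    (hδ0 : 0 ≤ δ) (hδ : ∀ x, probDist D (P x) π ≤ δ) :
    probDist D (push μ P) π ≤ 2 * rho D * probDist D μ π * δ := by
  cases D
  · simpa [rho, probDist] using tvDist_push_le hμ hπ hP hst hδ
  · have := hellingerDist_push_le hμ hπ hP hst hδ0 hδ
    simp only [rho, probDist]
    linarith

/-! ### Kernels as operators on summable functions -/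

/-- The Banach space `ℓ¹(X)`. -/
abbrev L1 (X : Type u) : Type u := lp (fun _ : X => ℝ) 1

theorem L1.summable_norm {X : Type u} (f : L1 X) : Summable fun x => ‖f x‖ := by
  simpa using (lp.memℓp f).summable (by simp)

theorem L1.norm_eq {X : Type u} (f : L1 X) : ‖f‖ = ∑' x, ‖f x‖ := by
  simpa using lp.norm_eq_tsum_rpow (p := 1) (by simp) f

/-- A summable function as an element of `ℓ¹`. -/
noncomputable def L1.mk {X : Type u} (f : X → ℝ) (hf : Summable fun x => ‖f x‖) : L1 X :=
  ⟨f, by apply memℓp_gen; simpa using hf⟩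

@[simp]
theorem L1.mk_apply {X : Type u} (f : X → ℝ) (hf : Summable fun x => ‖f x‖) (x : X) :
    L1.mk f hf x = f x := rfl

/-- The point mass at `x`. -/
noncomputable def L1.delta {X : Type u} (x : X) : L1 X :=
  L1.mk (idKernel x) (isProb_idKernel x).hasSum.summable.norm

theorem L1.hasSum_delta {X : Type u} (f : L1 X) : HasSum (fun x => f x • L1.delta x) f := by
  classical
  have h := lp.hasSum_single (p := 1) (by simp) f
  convert h using 2 with x
  ext y
  rw [lp.single_apply]
  by_cases hxy : y = x
  · subst hxy; simp [L1.delta, idKernel]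
  · simp [L1.delta, idKernel, hxy, Ne.symm hxy]

variable {E : Type v} [NormedAddCommGroup E] [NormedSpace ℝ E] [CompleteSpace E]

/-- The operator on `ℓ¹(X)` whose values at the point masses form a bounded family `a`. -/
noncomputable def L1.lift {X : Type u} (a : X → E) (ha : ∀ x, ‖a x‖ ≤ 1) : L1 X →L[ℝ] E :=
  have hn : ∀ f : L1 X, ∀ x, ‖f x • a x‖ ≤ ‖f x‖ := fun f x => by
    rw [norm_smul]; exact mul_le_of_le_one_right (norm_nonneg _) (ha x)
  have hs : ∀ f : L1 X, Summable fun x => ‖f x • a x‖ := fun f =>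
    Summable.of_nonneg_of_le (fun _ => norm_nonneg _) (hn f) (L1.summable_norm f)
  LinearMap.mkContinuous
    { toFun := fun f => ∑' x, f x • a x
      map_add' := fun f g => by
        rw [← (hs f).of_norm.tsum_add (hs g).of_norm]
        simp [add_smul]
      map_smul' := fun c f => by
        rw [RingHom.id_apply, ← (hs f).of_norm.tsum_const_smul c]
        simp [mul_smul] } 1
    (fun f => by
      rw [one_mul, L1.norm_eq]
      exact (norm_tsum_le_tsum_norm (hs f)).trans
        ((hs f).tsum_le_tsum (hn f) (L1.summable_norm f)))

theorem L1.lift_apply {X : Type u} (a : X → E) (ha : ∀ x, ‖a x‖ ≤ 1) (f : L1 X) :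
    L1.lift a ha f = ∑' x, f x • a x := rfl

theorem L1.lift_delta {X : Type u} (a : X → E) (ha : ∀ x, ‖a x‖ ≤ 1) (x : X) :
    L1.lift a ha (L1.delta x) = a x := by
  rw [L1.lift_apply, tsum_eq_single x]
  · simp [L1.delta, idKernel]
  · intro y hy; simp [L1.delta, idKernel, hy.symm]

theorem L1.map_apply {X : Type u} {Y : Type v} (A : L1 X →L[ℝ] L1 Y) (f : L1 X) (y : Y) :
    HasSum (fun x => f x * A (L1.delta x) y) (A f y) := by
  have h := ((L1.hasSum_delta f).mapL A).mapL (lp.evalCLM ℝ (fun _ : Y => ℝ) 1 y)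
  refine hasSum_of_forall_eq h fun x => ?_
  rw [map_smul, map_smul]; rfl

theorem L1.clm_ext {X : Type u} {Y : Type v} {A B : L1 X →L[ℝ] L1 Y}
    (h : ∀ x y, A (L1.delta x) y = B (L1.delta x) y) : A = B := by
  ext f y
  rw [← (L1.map_apply A f y).tsum_eq, ← (L1.map_apply B f y).tsum_eq]
  simp_rw [h]

theorem IsProb.norm_mk {X : Type u} {μ : X → ℝ} (h : IsProb μ) :
    ‖L1.mk μ h.hasSum.summable.norm‖ ≤ 1 := by
  rw [L1.norm_eq]
  simp only [L1.mk_apply, Real.norm_of_nonneg (h.nonneg _), h.hasSum.tsum_eq, le_refl]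

/-- The operator `μ ↦ μ K` of a stochastic matrix `K`. -/
noncomputable def kernelOp {X : Type u} (K : X → X → ℝ) (hK : ∀ x, IsProb (K x)) :
    L1 X →L[ℝ] L1 X :=
  L1.lift (fun x => L1.mk (K x) (hK x).hasSum.summable.norm) fun x => (hK x).norm_mk

theorem kernelOp_delta {X : Type u} (K : X → X → ℝ) (hK : ∀ x, IsProb (K x)) (x y : X) :
    kernelOp K hK (L1.delta x) y = K x y := by
  rw [kernelOp, L1.lift_delta]; rfl

/-- Identifies the entrywise matrix powers with operator powers, so that the algebra of
`NormedSpace.exp` becomes available. The operators act on masses, hence composition is the matrix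
product in reverse order. -/
theorem kernelOp_pow_delta {X : Type u} (K : X → X → ℝ) (hK : ∀ x, IsProb (K x)) (m : ℕ)
    (x y : X) : (kernelOp K hK ^ m) (L1.delta x) y = kernelPow K m x y := by
  induction m generalizing x with
  | zero => rfl
  | succ m ih =>
    rw [pow_succ, mul_apply_eq_comp, ← (L1.map_apply _ _ y).tsum_eq]
    simp_rw [ih, kernelOp_delta]
    rfl

theorem hasSum_exp_delta {X : Type u} (K : X → X → ℝ) (hK : ∀ x, IsProb (K x)) (t : ℝ)
    (x y : X) : HasSum (fun m : ℕ => t ^ m / (m.factorial : ℝ) * kernelPow K m x y)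
      (NormedSpace.exp (t • kernelOp K hK) (L1.delta x) y) := by
  have h := NormedSpace.exp_series_hasSum_exp' (𝕂 := ℝ) (t • kernelOp K hK)
  have h2 := (h.mapL (ContinuousLinearMap.apply ℝ (L1 X) (L1.delta x))).mapL
    (lp.evalCLM ℝ (fun _ : X => ℝ) 1 y)
  refine hasSum_of_forall_eq h2 fun m => ?_
  rw [smul_pow, smul_smul, map_smul, map_smul, ← kernelOp_pow_delta K hK]
  simp only [smul_eq_mul]
  rw [div_eq_inv_mul]
  rfl

theorem heatKernel_eq_exp {X : Type u} (K : X → X → ℝ) (hK : ∀ x, IsProb (K x)) (t : ℝ)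
    (x y : X) : heatKernel K t x y
      = Real.exp (-t) * NormedSpace.exp (t • kernelOp K hK) (L1.delta x) y := by
  rw [heatKernel, (hasSum_exp_delta K hK t x y).tsum_eq]

theorem isProb_kernelPow {X : Type u} {K : X → X → ℝ} (hK : ∀ x, IsProb (K x)) (m : ℕ) (x : X) :
    IsProb (kernelPow K m x) := by
  induction m generalizing x with
  | zero => exact isProb_idKernel x
  | succ m ih => exact (hK x).push ih

theorem hasSum_poisson (t : ℝ) :
    HasSum (fun m : ℕ => Real.exp (-t) * (t ^ m / (m.factorial : ℝ))) 1 := by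
  have h := (NormedSpace.expSeries_div_hasSum_exp t).mul_left (Real.exp (-t))
  rw [← Real.exp_eq_exp_ℝ, ← Real.exp_add, neg_add_cancel, Real.exp_zero] at h
  exact h

theorem heatKernel_eq_tsum {X : Type u} (K : X → X → ℝ) (t : ℝ) (x y : X) :
    heatKernel K t x y
      = ∑' m : ℕ, Real.exp (-t) * (t ^ m / (m.factorial : ℝ)) * kernelPow K m x y := by
  rw [heatKernel, ← tsum_mul_left]
  simp_rw [mul_assoc]

theorem isProb_heatKernel {X : Type u} {K : X → X → ℝ} (hK : ∀ x, IsProb (K x)) {t : ℝ}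
    (ht : 0 ≤ t) (x : X) : IsProb (heatKernel K t x) := by
  have hc : ∀ m : ℕ, 0 ≤ Real.exp (-t) * (t ^ m / (m.factorial : ℝ)) := fun m => by positivity
  have h := (hasSum_swap (f := fun (m : ℕ) y =>
    Real.exp (-t) * (t ^ m / (m.factorial : ℝ)) * kernelPow K m x y)
    (fun m y => mul_nonneg (hc m) ((isProb_kernelPow hK m x).nonneg y))
    (fun m => by simpa using (isProb_kernelPow hK m x).hasSum.mul_left _) (hasSum_poisson t)).2
  refine ⟨fun y => ?_, hasSum_of_forall_eq h fun y => heatKernel_eq_tsum K t x y⟩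
  rw [heatKernel_eq_tsum]
  exact tsum_nonneg fun m => mul_nonneg (hc m) ((isProb_kernelPow hK m x).nonneg y)

theorem push_heatKernel {X : Type u} {K : X → X → ℝ} (hK : ∀ x, IsProb (K x)) (s t : ℝ)
    (x : X) : push (heatKernel K s x) (heatKernel K t) = heatKernel K (s + t) x := by
  ext y
  have hexp : NormedSpace.exp ((s + t) • kernelOp K hK)
      = NormedSpace.exp (t • kernelOp K hK) * NormedSpace.exp (s • kernelOp K hK) := by
    -- The addition formula for `NormedSpace.exp` is used with the rational scalars inherited from
    -- `ℝ`.
    let _ : NormedAlgebra ℚ (L1 X →L[ℝ] L1 X) := NormedAlgebra.restrictScalars ℚ ℝ _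
    rw [add_comm, add_smul]
    exact NormedSpace.exp_add_of_commute
      (((Commute.refl _).smul_left t).smul_right s)
  have h := (L1.map_apply (NormedSpace.exp (t • kernelOp K hK))
    (NormedSpace.exp (s • kernelOp K hK) (L1.delta x)) y).tsum_eq
  rw [heatKernel_eq_exp K hK (s + t), hexp, mul_apply_eq_comp, ← h, push, neg_add,
    Real.exp_add, ← tsum_mul_left]
  refine tsum_congr fun z => ?_
  rw [heatKernel_eq_exp K hK s, heatKernel_eq_exp K hK t]
  ring

theorem push_kernelPow_of_stationary {X : Type u} {K : X → X → ℝ} (hK : ∀ x, IsProb (K x))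
    {π : X → ℝ} (hπ : IsProb π) (hst : push π K = π) (m : ℕ) : push π (kernelPow K m) = π := by
  have hop : kernelOp K hK (L1.mk π hπ.hasSum.summable.norm)
      = L1.mk π hπ.hasSum.summable.norm := by
    ext y
    rw [← (L1.map_apply _ _ y).tsum_eq]
    simp_rw [kernelOp_delta]
    exact congrFun hst y
  have hpow : (kernelOp K hK ^ m) (L1.mk π hπ.hasSum.summable.norm)
      = L1.mk π hπ.hasSum.summable.norm := by
    induction m with
    | zero => rfl
    | succ m ih => rw [pow_succ, mul_apply_eq_comp, hop, ih]
  ext y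
  have h := (L1.map_apply (kernelOp K hK ^ m) (L1.mk π hπ.hasSum.summable.norm) y).tsum_eq
  rw [hpow] at h
  simp_rw [kernelOp_pow_delta] at h
  exact h

/-- The heat kernel is a Poisson mixture of the powers of `K`, each of which preserves `π`. -/
theorem push_heatKernel_of_stationary {X : Type u} {K : X → X → ℝ} (hK : ∀ x, IsProb (K x))
    {π : X → ℝ} (hπ : IsProb π) (hst : push π K = π) {t : ℝ} (ht : 0 ≤ t) :
    push π (heatKernel K t) = π := by
  ext y
  have hc : ∀ m : ℕ, 0 ≤ Real.exp (-t) * (t ^ m / (m.factorial : ℝ)) := fun m => by positivity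
  have hrow : ∀ m : ℕ, HasSum (fun x => Real.exp (-t) * (t ^ m / (m.factorial : ℝ)) *
      (π x * kernelPow K m x y)) (Real.exp (-t) * (t ^ m / (m.factorial : ℝ)) * π y) := fun m => by
    have h := (hπ.summable_mul (isProb_kernelPow hK m) y).hasSum.mul_left
      (Real.exp (-t) * (t ^ m / (m.factorial : ℝ)))
    have h2 : ∑' x, π x * kernelPow K m x y = π y :=
      congrFun (push_kernelPow_of_stationary hK hπ hst m) y
    rwa [h2] at h
  have h := (hasSum_swap (fun m x => mul_nonneg (hc m) (mul_nonneg (hπ.nonneg x)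
    ((isProb_kernelPow hK m x).nonneg y))) hrow ((hasSum_poisson t).mul_right (π y))).2
  rw [one_mul] at h
  rw [push, ← h.tsum_eq]
  refine tsum_congr fun x => ?_
  rw [heatKernel_eq_tsum, ← tsum_mul_left]
  refine tsum_congr fun m => ?_
  ring

/-- With probability `exp (-t)` the Poisson clock has not rung: this is the term `m = 0`. -/
theorem exp_neg_le_heatKernel_self {X : Type u} {K : X → X → ℝ} (hK : ∀ x, IsProb (K x)) {t : ℝ}
    (ht : 0 ≤ t) (x : X) : Real.exp (-t) ≤ heatKernel K t x x := by
  rw [heatKernel_eq_exp K hK]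
  refine le_mul_of_one_le_right (Real.exp_pos _).le ?_
  have h := le_hasSum (hasSum_exp_delta K hK t x x) 0 fun m _ =>
    mul_nonneg (by positivity) ((isProb_kernelPow hK m x).nonneg x)
  simpa [kernelPow, idKernel] using h

/-! ### Tensor products of kernels -/

theorem hasSum_pi_prod {N : ℕ} {X : Fin N → Type u} {f : ∀ i, X i → ℝ} {a : Fin N → ℝ}
    (hf : ∀ i x, 0 ≤ f i x) (h : ∀ i, HasSum (f i) (a i)) :
    HasSum (fun x : ∀ i, X i => ∏ i, f i (x i)) (∏ i, a i) := by
  induction N with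
  | zero =>
    simp
  | succ N ih =>
    have h1 := ih (f := fun i => f i.succ) (fun i => hf i.succ) fun i => h i.succ
    have hs := (h 0).summable.mul_of_nonneg h1.summable (hf 0)
      fun x => Finset.prod_nonneg fun i _ => hf i.succ (x i)
    have h2 := (h 0).mul h1 hs
    rw [Fin.prod_univ_succ, ← (Fin.consEquiv X).hasSum_iff]
    refine hasSum_of_forall_eq h2 fun z => ?_
    simp [Fin.prod_univ_succ, Fin.consEquiv]

theorem isProb_pi_prod {N : ℕ} {X : Fin N → Type u} {μ : ∀ i, X i → ℝ}
    (h : ∀ i, IsProb (μ i)) : IsProb fun x : ∀ i, X i => ∏ i, μ i (x i) :=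
  ⟨fun x => Finset.prod_nonneg fun i _ => (h i).nonneg (x i), by
    simpa using hasSum_pi_prod (fun i => (h i).nonneg) fun i => (h i).hasSum⟩

/-- The tensor product of the kernels `A i`. -/
noncomputable def tensor {N : ℕ} {X : Fin N → Type u} (A : ∀ i, X i → X i → ℝ)
    (x y : ∀ i, X i) : ℝ :=
  ∏ i, A i (x i) (y i)

theorem isProb_tensor {N : ℕ} {X : Fin N → Type u} {A : ∀ i, X i → X i → ℝ}
    (hA : ∀ i x, IsProb (A i x)) (x : ∀ i, X i) : IsProb (tensor A x) :=
  isProb_pi_prod fun i => hA i (x i)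

theorem push_pi_prod {N : ℕ} {X : Fin N → Type u} {Y : Fin N → Type v} {μ : ∀ i, X i → ℝ}
    (hμ : ∀ i, IsProb (μ i)) {B : ∀ i, X i → Y i → ℝ} (hB : ∀ i x, IsProb (B i x))
    (y : ∀ i, Y i) :
    ∑' x : ∀ i, X i, (∏ i, μ i (x i)) * ∏ i, B i (x i) (y i) = ∏ i, push (μ i) (B i) (y i) := by
  have h := hasSum_pi_prod (f := fun i z => μ i z * B i z (y i))
    (fun i z => mul_nonneg ((hμ i).nonneg z) ((hB i z).nonneg (y i)))
    fun i => ((hμ i).summable_mul (hB i) (y i)).hasSum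
  simp_rw [Finset.prod_mul_distrib] at h
  exact h.tsum_eq

theorem push_tensor {N : ℕ} {X : Fin N → Type u} {A B : ∀ i, X i → X i → ℝ}
    (hA : ∀ i x, IsProb (A i x)) (hB : ∀ i x, IsProb (B i x)) (x : ∀ i, X i) :
    push (tensor A x) (tensor B) = tensor (fun i x => push (A i x) (B i)) x := by
  ext y
  exact push_pi_prod (fun i => hA i (x i)) hB y

theorem idKernel_pi {N : ℕ} {X : Fin N → Type u} (x y : ∀ i, X i) :
    idKernel x y = ∏ i, idKernel (x i) (y i) := by
  classical
  simp only [idKernel, Finset.prod_ite_zero, Finset.prod_const_one, Finset.mem_univ, true_imp_iff,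
    funext_iff]

/-- The family of kernels `A i` for `i ∈ S` and the identity elsewhere. -/
noncomputable def onSet {N : ℕ} {X : Fin N → Type u} (A : ∀ i, X i → X i → ℝ)
    (S : Finset (Fin N)) : ∀ i, X i → X i → ℝ :=
  fun i => if i ∈ S then A i else idKernel

theorem isProb_onSet {N : ℕ} {X : Fin N → Type u} {A : ∀ i, X i → X i → ℝ}
    (hA : ∀ i x, IsProb (A i x)) (S : Finset (Fin N)) (i : Fin N) (x : X i) :
    IsProb (onSet A S i x) := by
  unfold onSet
  split_ifs
  · exact hA i x
  · exact isProb_idKernel x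

theorem push_idKernel {X : Type u} (μ : X → ℝ) : push μ idKernel = μ :=
  funext fun y => sum_mul_idKernel μ y

theorem push_of_idKernel {X : Type u} (A : X → X → ℝ) (x : X) : push (idKernel x) A = A x :=
  funext fun y => sum_idKernel_mul (fun z => A z y) x

theorem kernelPow_tensor_onSet {N : ℕ} {X : Fin N → Type u} {K : ∀ i, X i → X i → ℝ}
    (hK : ∀ i x, IsProb (K i x)) (i : Fin N) (m : ℕ) :
    kernelPow (tensor (onSet K {i})) m = tensor (onSet (fun j => kernelPow (K j) m) {i}) := by
  induction m with
  | zero =>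
    ext x y
    rw [kernelPow, idKernel_pi, tensor]
    refine Finset.prod_congr rfl fun j _ => ?_
    simp [onSet, kernelPow]
  | succ m ih =>
    ext x
    change push (tensor (onSet K {i}) x) (kernelPow (tensor (onSet K {i})) m) _ = _
    rw [ih, push_tensor (isProb_onSet hK {i})
      (isProb_onSet (fun j => isProb_kernelPow (hK j) m) {i})]
    refine Finset.prod_congr rfl fun j _ => ?_
    by_cases hj : j = i
    · simp only [onSet, hj, Finset.mem_singleton, if_true]; rfl
    · simp only [onSet, hj, Finset.mem_singleton, if_false, push_idKernel]

theorem tensor_onSet_singleton {N : ℕ} {X : Fin N → Type u} (A : ∀ i, X i → X i → ℝ) (i : Fin N)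
    (x y : ∀ i, X i) : tensor (onSet A {i}) x y
      = A i (x i) (y i) * ∏ j ∈ Finset.univ.erase i, idKernel (x j) (y j) := by
  rw [tensor, ← Finset.mul_prod_erase _ _ (Finset.mem_univ i)]
  congr 1
  · simp [onSet]
  · refine Finset.prod_congr rfl fun j hj => ?_
    simp [onSet, Finset.ne_of_mem_erase hj]

theorem heatKernel_tensor_onSet {N : ℕ} {X : Fin N → Type u} {K : ∀ i, X i → X i → ℝ}
    (hK : ∀ i x, IsProb (K i x)) (i : Fin N) (t : ℝ) :
    heatKernel (tensor (onSet K {i})) t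
      = tensor (onSet (fun j => heatKernel (K j) t) {i}) := by
  ext x y
  rw [tensor_onSet_singleton, heatKernel, heatKernel, mul_assoc, ← tsum_mul_right]
  simp_rw [kernelPow_tensor_onSet hK, tensor_onSet_singleton, mul_assoc]

/-! ### The heat kernel of a product chain -/

/-- Moves in different coordinates commute, since in each coordinate at least one of the two factors
is the identity. -/
theorem commute_kernelOp_tensor_onSet {N : ℕ} {X : Fin N → Type u} {K : ∀ i, X i → X i → ℝ}
    (hK : ∀ i x, IsProb (K i x)) (i j : Fin N) :
    Commute (kernelOp (tensor (onSet K {i})) (isProb_tensor (isProb_onSet hK {i})))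
      (kernelOp (tensor (onSet K {j})) (isProb_tensor (isProb_onSet hK {j}))) := by
  have key : ∀ i j : Fin N, ∀ x y,
      (kernelOp (tensor (onSet K {i})) (isProb_tensor (isProb_onSet hK {i})) *
        kernelOp (tensor (onSet K {j})) (isProb_tensor (isProb_onSet hK {j}))) (L1.delta x) y
      = ∏ l, push (onSet K {j} l (x l)) (onSet K {i} l) (y l) := by
    intro i j x y
    rw [mul_apply_eq_comp, ← (L1.map_apply _ _ y).tsum_eq]
    simp_rw [kernelOp_delta]
    exact push_pi_prod (fun l => isProb_onSet hK {j} l (x l)) (isProb_onSet hK {i}) y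
  refine L1.clm_ext fun x y => ?_
  rw [key, key]
  refine Finset.prod_congr rfl fun l _ => ?_
  simp only [onSet, Finset.mem_singleton]
  split_ifs <;> simp [push_idKernel, push_of_idKernel]

/-- By commutation the exponential of the sum is the product of the exponentials, and each of these
moves a single coordinate by its own heat kernel. The induction adds one coordinate at a time; the
factor `Real.exp (∑ i ∈ S, τ i)` undoes the normalisation of the heat kernels. -/
theorem exp_sum_kernelOp_tensor {N : ℕ} {X : Fin N → Type u} {K : ∀ i, X i → X i → ℝ}
    (hK : ∀ i x, IsProb (K i x)) {τ : Fin N → ℝ} (hτ : ∀ i, 0 ≤ τ i) (S : Finset (Fin N))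
    (x y : ∀ i, X i) :
    NormedSpace.exp (∑ i ∈ S, τ i •
      kernelOp (tensor (onSet K {i})) (isProb_tensor (isProb_onSet hK {i}))) (L1.delta x) y
      = Real.exp (∑ i ∈ S, τ i) * tensor (onSet (fun j => heatKernel (K j) (τ j)) S) x y := by
  classical
  induction S using Finset.induction_on generalizing y with
  | empty =>
    simp only [Finset.sum_empty, NormedSpace.exp_zero, Real.exp_zero, one_mul]
    change idKernel x y = _
    rw [idKernel_pi, tensor]
    simp [onSet]
  | insert a S ha ih =>
    let _ : NormedAlgebra ℚ (L1 (∀ i, X i) →L[ℝ] L1 (∀ i, X i)) :=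
      NormedAlgebra.restrictScalars ℚ ℝ _
    have hcomm : Commute
        (τ a • kernelOp (tensor (onSet K {a})) (isProb_tensor (isProb_onSet hK {a})))
        (∑ i ∈ S, τ i • kernelOp (tensor (onSet K {i})) (isProb_tensor (isProb_onSet hK {i}))) :=
      Commute.sum_right _ _ _ fun i _ =>
        ((commute_kernelOp_tensor_onSet hK a i).smul_left _).smul_right _
    rw [Finset.sum_insert ha, NormedSpace.exp_add_of_commute hcomm, mul_apply_eq_comp,
      ← (L1.map_apply _ _ y).tsum_eq, Finset.sum_insert ha, Real.exp_add]
    have hterm : ∀ z, NormedSpace.exp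
        (τ a • kernelOp (tensor (onSet K {a})) (isProb_tensor (isProb_onSet hK {a})))
        (L1.delta z) y = Real.exp (τ a) *
          tensor (onSet (fun j => heatKernel (K j) (τ a)) {a}) z y := fun z => by
      rw [← heatKernel_tensor_onSet hK, heatKernel_eq_exp _ (isProb_tensor (isProb_onSet hK {a})),
        ← mul_assoc, ← Real.exp_add, add_neg_cancel, Real.exp_zero, one_mul]
    have hH : ∀ i x, IsProb (heatKernel (K i) (τ i) x) := fun i x =>
      isProb_heatKernel (hK i) (hτ i) x
    have hpush := congrFun (push_tensor (isProb_onSet hH S)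
      (isProb_onSet (A := fun j => heatKernel (K j) (τ a))
        (fun i x => isProb_heatKernel (hK i) (hτ a) x) {a}) x) y
    -- Since `a ∉ S`, in every coordinate one of the two kernels composed on the right is the
    -- identity.
    have hfin : tensor (onSet (fun j => heatKernel (K j) (τ j)) (insert a S)) x y
        = ∑' z, tensor (onSet (fun j => heatKernel (K j) (τ j)) S) x z *
          tensor (onSet (fun j => heatKernel (K j) (τ a)) {a}) z y := by
      refine Eq.trans (Finset.prod_congr rfl fun l _ => ?_) hpush.symm
      by_cases hl : l = a
      · subst hl
        simp [onSet, ha, push_of_idKernel]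
      · simp [onSet, hl, push_idKernel]
    rw [hfin, ← tsum_mul_left]
    refine tsum_congr fun z => ?_
    rw [ih, hterm]
    ring

theorem prodKernel_eq_sum {N : ℕ} {X : Fin N → Type u} (w : Fin N → ℝ)
    (K : ∀ i, X i → X i → ℝ) (x y : ∀ i, X i) :
    prodKernel w K x y = ∑ i, w i * tensor (onSet K {i}) x y := by
  refine Finset.sum_congr rfl fun i _ => ?_
  congr 1
  refine Finset.prod_congr rfl fun j _ => ?_
  by_cases hj : j = i <;> simp [onSet, hj]

theorem isProb_prodKernel {N : ℕ} {X : Fin N → Type u} {w : Fin N → ℝ} (hw : ∀ i, 0 ≤ w i)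
    (hw1 : ∑ i, w i = 1) {K : ∀ i, X i → X i → ℝ} (hK : ∀ i x, IsProb (K i x)) (x : ∀ i, X i) :
    IsProb (prodKernel w K x) := by
  have ht := fun i => isProb_tensor (isProb_onSet hK {i}) x
  refine ⟨fun y => ?_, ?_⟩
  · rw [prodKernel_eq_sum]
    exact Finset.sum_nonneg fun i _ => mul_nonneg (hw i) ((ht i).nonneg y)
  · have h := hasSum_sum (s := Finset.univ) fun i _ => (ht i).hasSum.mul_left (w i)
    simp only [mul_one, hw1] at h
    exact hasSum_of_forall_eq h fun y => prodKernel_eq_sum w K x y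

theorem heatKernel_prodKernel {N : ℕ} {X : Fin N → Type u} {w : Fin N → ℝ} (hw : ∀ i, 0 ≤ w i)
    (hw1 : ∑ i, w i = 1) {K : ∀ i, X i → X i → ℝ} (hK : ∀ i x, IsProb (K i x)) {t : ℝ}
    (ht : 0 ≤ t) (x y : ∀ i, X i) :
    heatKernel (prodKernel w K) t x y = ∏ i, heatKernel (K i) (w i * t) (x i) (y i) := by
  have hop : t • kernelOp (prodKernel w K) (isProb_prodKernel hw hw1 hK)
      = ∑ i, (w i * t) • kernelOp (tensor (onSet K {i})) (isProb_tensor (isProb_onSet hK {i})) := by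
    refine L1.clm_ext fun x y => ?_
    rw [sum_apply, lp.coeFn_sum, Finset.sum_apply]
    simp only [smul_apply, lp.coeFn_smul, Pi.smul_apply, smul_eq_mul,
      kernelOp_delta, prodKernel_eq_sum, Finset.mul_sum]
    exact Finset.sum_congr rfl fun i _ => by ring
  rw [heatKernel_eq_exp _ (isProb_prodKernel hw hw1 hK), hop,
    exp_sum_kernelOp_tensor hK (fun i => mul_nonneg (hw i) ht), ← Finset.sum_mul, hw1, one_mul,
    ← mul_assoc, ← Real.exp_add, neg_add_cancel, Real.exp_zero, one_mul, tensor]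
  simp [onSet]

/-! ### The maximum distance of a continuous time chain -/

theorem IsIrreducibleChain.isProb_row {X : Type u} {K : X → X → ℝ} {π : X → ℝ}
    (h : IsIrreducibleChain K π) (x : X) : IsProb (K x) :=
  ⟨h.nonneg x, h.hasSum_row x⟩

theorem IsIrreducibleChain.isProb_pi {X : Type u} {K : X → X → ℝ} {π : X → ℝ}
    (h : IsIrreducibleChain K π) : IsProb π :=
  ⟨h.pi_nonneg, h.hasSum_pi⟩

theorem IsIrreducibleChain.push_eq {X : Type u} {K : X → X → ℝ} {π : X → ℝ}
    (h : IsIrreducibleChain K π) : push π K = π :=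
  funext fun y => (h.stationary y).tsum_eq

section MaxDist

variable {X : Type u} {K : X → X → ℝ} {π : X → ℝ} (D : DistKind)

theorem bddAbove_probDist (hK : ∀ x, IsProb (K x)) (hπ : IsProb π) {t : ℝ} (ht : 0 ≤ t) :
    BddAbove (Set.range fun x => probDist D (heatKernel K t x) π) :=
  ⟨1, Set.forall_mem_range.2 fun x => probDist_le_one D (isProb_heatKernel hK ht x) hπ⟩

theorem probDist_le_maxDist (hK : ∀ x, IsProb (K x)) (hπ : IsProb π) {t : ℝ} (ht : 0 ≤ t) (x : X) :
    probDist D (heatKernel K t x) π ≤ maxDist D K π t :=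
  le_ciSup (bddAbove_probDist D hK hπ ht) x

theorem maxDist_nonneg (hK : ∀ x, IsProb (K x)) (hπ : IsProb π) {t : ℝ} (ht : 0 ≤ t) :
    0 ≤ maxDist D K π t :=
  Real.iSup_nonneg fun x => probDist_nonneg D (isProb_heatKernel hK ht x) hπ

theorem maxDist_le_one (hK : ∀ x, IsProb (K x)) (hπ : IsProb π) {t : ℝ} (ht : 0 ≤ t) :
    maxDist D K π t ≤ 1 :=
  Real.iSup_le (fun x => probDist_le_one D (isProb_heatKernel hK ht x) hπ) zero_le_one

theorem maxDist_le_of_le (hK : ∀ x, IsProb (K x)) (hπ : IsProb π) (hst : push π K = π) {s t : ℝ}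
    (hs : 0 ≤ s) (hst' : s ≤ t) : maxDist D K π t ≤ maxDist D K π s := by
  refine Real.iSup_le (fun x => ?_) (maxDist_nonneg D hK hπ hs)
  have h := probDist_push_le D (isProb_heatKernel hK hs x) hπ
    (isProb_heatKernel hK (sub_nonneg.2 hst'))
  rw [push_heatKernel hK, push_heatKernel_of_stationary hK hπ hst (sub_nonneg.2 hst'),
    add_sub_cancel] at h
  exact h.trans (probDist_le_maxDist D hK hπ hs x)

/-- The first stretch of time supplies the initial mass, the second the kernel, in
`probDist_push_le_mul`. -/
theorem maxDist_add_le (hK : ∀ x, IsProb (K x)) (hπ : IsProb π) (hst : push π K = π) {s t : ℝ}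
    (hs : 0 ≤ s) (ht : 0 ≤ t) :
    maxDist D K π (s + t) ≤ 2 * rho D * maxDist D K π s * maxDist D K π t := by
  have hρ := rho_pos D
  have h1 := maxDist_nonneg D hK hπ hs
  have h2 := maxDist_nonneg D hK hπ ht
  refine Real.iSup_le (fun x => ?_) (by positivity)
  have h := probDist_push_le_mul D (isProb_heatKernel hK hs x) hπ (isProb_heatKernel hK ht)
    (push_heatKernel_of_stationary hK hπ hst ht) h2 (probDist_le_maxDist D hK hπ ht)
  rw [push_heatKernel hK] at h
  refine h.trans ?_
  have := probDist_le_maxDist D hK hπ hs x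
  gcongr

theorem maxDist_nat_mul_le (hK : ∀ x, IsProb (K x)) (hπ : IsProb π) (hst : push π K = π) {t : ℝ}
    (ht : 0 ≤ t) (m : ℕ) : maxDist D K π (m * t) ≤ (2 * rho D * maxDist D K π t) ^ m := by
  have hρ := rho_pos D
  have h2 := maxDist_nonneg D hK hπ ht
  induction m with
  | zero => simpa using maxDist_le_one D hK hπ le_rfl
  | succ m ih =>
    have hmt : 0 ≤ (m : ℝ) * t := by positivity
    have h := maxDist_add_le D hK hπ hst hmt ht
    rw [show ((m + 1 : ℕ) : ℝ) * t = m * t + t by push_cast; ring, pow_succ]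
    refine h.trans ?_
    calc 2 * rho D * maxDist D K π (m * t) * maxDist D K π t
        = maxDist D K π (m * t) * (2 * rho D * maxDist D K π t) := by ring
      _ ≤ _ := by gcongr

theorem maxDist_le_of_mixingTime_lt (hK : ∀ x, IsProb (K x)) (hπ : IsProb π)
    (hst : push π K = π) {ε t : ℝ} (hfin : MixingTimeFinite D K π ε)
    (ht : mixingTime D K π ε < t) : maxDist D K π t ≤ ε := by
  obtain ⟨s, ⟨hs0, hs⟩, hst'⟩ := exists_lt_of_csInf_lt hfin ht
  exact (maxDist_le_of_le D hK hπ hst hs0 hst'.le).trans hs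

theorem lt_maxDist_of_lt_mixingTime {ε t : ℝ} (ht0 : 0 ≤ t) (ht : t < mixingTime D K π ε) :
    ε < maxDist D K π t := by
  by_contra h
  exact absurd ht (not_lt.2 (csInf_le ⟨0, fun s hs => hs.1⟩ ⟨ht0, not_lt.1 h⟩))

/-- The minimum is at most `ν` at the point `x` and at most `μ` elsewhere. -/
theorem affinity_TV_le {μ ν : X → ℝ} (hμ : IsProb μ) (hν : IsProb ν) (x : X) :
    affinity DistKind.TV μ ν ≤ 1 + ν x - μ x := by
  have hs := summable_overlap DistKind.TV hμ.nonneg hν.nonneg hμ.hasSum.summable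
    hν.hasSum.summable
  have h := hμ.hasSum.add ((isProb_idKernel x).hasSum.mul_right (ν x - μ x))
  have := hasSum_le (fun y => ?_) hs.hasSum h
  · rw [affinity]; linarith
  · by_cases hy : x = y
    · subst hy; simp [idKernel, overlap]
    · simp [idKernel, overlap, hy]

/-- Away from `x`, `√μ √ν ≤ 2 μ + ν / 8` by `(4√μ - √ν) ^ 2 ≥ 0`; at `x` the product is at most `3 /
4` because `ν x ≤ 1 / 2 ≤ 9 / 16`. -/
theorem affinity_H_le {μ ν : X → ℝ} (hμ : IsProb μ) (hν : IsProb ν) {x : X} (hx : ν x ≤ 1 / 2) :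
    affinity DistKind.H μ ν ≤ 7 / 8 + 2 * (1 - μ x) := by
  have hs := summable_overlap DistKind.H hμ.nonneg hν.nonneg hμ.hasSum.summable
    hν.hasSum.summable
  have h := ((hμ.hasSum.mul_left 2).add (hν.hasSum.mul_left (1 / 8))).add
    ((isProb_idKernel x).hasSum.mul_right (3 / 4 - 2 * μ x - 1 / 8 * ν x))
  have := hasSum_le (fun y => ?_) hs.hasSum h
  · rw [affinity]; linarith [hν.nonneg x]
  · by_cases hy : x = y
    · subst hy
      have h1 : √(μ x) ≤ 1 := Real.sqrt_le_one.2 (hμ.le_one x)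
      have h2 : √(ν x) ≤ 3 / 4 := Real.sqrt_le_iff.2 ⟨by norm_num, by linarith⟩
      simp only [idKernel, overlap, if_true]
      nlinarith [Real.sqrt_nonneg (μ x), Real.sqrt_nonneg (ν x)]
    · simp only [idKernel, overlap, hy, if_false]
      nlinarith [Real.sq_sqrt (hμ.nonneg y), Real.sq_sqrt (hν.nonneg y),
        sq_nonneg (4 * √(μ y) - √(ν y))]

theorem IsProb.exists_le_half [Nontrivial X] {ν : X → ℝ} (hν : IsProb ν) : ∃ x, ν x ≤ 1 / 2 := by
  classical
  obtain ⟨x, y, hxy⟩ := exists_pair_ne X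
  have h := sum_le_hasSum {x, y} (fun z _ => hν.nonneg z) hν.hasSum
  rw [Finset.sum_pair hxy] at h
  by_contra! hc
  linarith [hc x, hc y]

/-- Started at a point of stationary mass at most `1 / 2`, the chain has hardly moved at small
times. This makes mixing times at levels below `1 / (2ϱ)` strictly positive, so that they can serve
as denominators. -/
theorem exists_pos_lt_maxDist [Nontrivial X] (hK : ∀ x, IsProb (K x)) (hπ : IsProb π) {ε : ℝ}
    (hε0 : 0 < ε) (hε : ε < 1 / (2 * rho D)) : ∃ t, 0 < t ∧ ε < maxDist D K π t := by
  obtain ⟨x, hx⟩ := hπ.exists_le_half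
  cases D
  · simp only [rho] at hε
    -- At time `t` the distance is at least `exp (-t) - 1 / 2 ≥ 1 / 2 - t`.
    have ht : 0 < (1 / 2 - ε) / 2 := by linarith
    refine ⟨_, ht, lt_of_lt_of_le ?_ (probDist_le_maxDist DistKind.TV hK hπ ht.le x)⟩
    simp only [probDist]
    rw [tvDist_eq (isProb_heatKernel hK ht.le x) hπ]
    have h1 := affinity_TV_le (isProb_heatKernel hK ht.le x) hπ x
    have h2 := exp_neg_le_heatKernel_self hK ht.le x
    have h3 := Real.add_one_le_exp (-((1 / 2 - ε) / 2))
    linarith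
  · simp only [rho] at hε
    -- At time `t` the squared distance is at least `1 / 8 - 2 t = 3 / 32`, above `(1 / 4) ^ 2`.
    have ht : (0 : ℝ) < 1 / 64 := by norm_num
    refine ⟨_, ht, lt_of_lt_of_le ?_ (probDist_le_maxDist DistKind.H hK hπ ht.le x)⟩
    refine lt_of_pow_lt_pow_left₀ 2 (Real.sqrt_nonneg _) ?_
    change ε ^ 2 < hellingerDist _ _ ^ 2
    rw [hellingerDist_sq (isProb_heatKernel hK ht.le x) hπ]
    have h1 := affinity_H_le (isProb_heatKernel hK ht.le x) hπ hx
    have h2 := exp_neg_le_heatKernel_self hK ht.le x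
    have h3 := Real.add_one_le_exp (-(1 / 64 : ℝ))
    nlinarith

theorem mixingTime_pos [Nontrivial X] (hK : ∀ x, IsProb (K x)) (hπ : IsProb π)
    (hst : push π K = π) {ε : ℝ} (hε0 : 0 < ε) (hε : ε < 1 / (2 * rho D))
    (hfin : MixingTimeFinite D K π ε) : 0 < mixingTime D K π ε := by
  obtain ⟨t, ht0, ht⟩ := exists_pos_lt_maxDist D hK hπ hε0 hε
  refine ht0.trans_le ?_
  by_contra! h
  exact absurd ht (not_lt.2 (maxDist_le_of_mixingTime_lt D hK hπ hst hfin h))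

/-- Submultiplicativity over `⌊t / u⌋` blocks of length `u` gives exponential decay; the rounding
costs the `-1` in the exponent. -/
theorem maxDist_le_rpow [Nontrivial X] (hK : ∀ x, IsProb (K x)) (hπ : IsProb π)
    (hst : push π K = π) {ε : ℝ} (hε0 : 0 < ε) (hε : ε < 1 / (2 * rho D))
    (hfin : MixingTimeFinite D K π ε) {t : ℝ} (ht : 0 ≤ t) :
    maxDist D K π t ≤ (2 * rho D * ε) ^ (t / mixingTime D K π ε - 1) := by
  have hρ := rho_pos D
  have hT := mixingTime_pos D hK hπ hst hε0 hε hfin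
  have hb0 : 0 < 2 * rho D * ε := by positivity
  have hb1 : 2 * rho D * ε ≤ 1 := by
    rw [lt_div_iff₀ (by positivity)] at hε; linarith
  set T := mixingTime D K π ε with hTdef
  -- The infimum defining `T` is not known to be attained, so the bound is proved for `u > T` and
  -- then `u` decreases to `T`.
  have key : ∀ u, T < u → maxDist D K π t ≤ (2 * rho D * ε) ^ (t / u - 1) := by
    intro u hu
    have hu0 : 0 < u := hT.trans hu
    have hd := maxDist_le_of_mixingTime_lt D hK hπ hst hfin hu
    have hle : (⌊t / u⌋₊ : ℝ) * u ≤ t := by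
      rw [← le_div_iff₀ hu0]; exact Nat.floor_le (by positivity)
    calc maxDist D K π t ≤ maxDist D K π (⌊t / u⌋₊ * u) :=
          maxDist_le_of_le D hK hπ hst (by positivity) hle
      _ ≤ (2 * rho D * maxDist D K π u) ^ ⌊t / u⌋₊ := maxDist_nat_mul_le D hK hπ hst hu0.le _
      _ ≤ (2 * rho D * ε) ^ ⌊t / u⌋₊ := by
          have := maxDist_nonneg D hK hπ hu0.le
          gcongr
      _ = (2 * rho D * ε) ^ (⌊t / u⌋₊ : ℝ) := (Real.rpow_natCast _ _).symm
      _ ≤ (2 * rho D * ε) ^ (t / u - 1) :=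
          Real.rpow_le_rpow_of_exponent_ge hb0 hb1 (Nat.sub_one_lt_floor _).le
  have hcont : Tendsto (fun u => (2 * rho D * ε) ^ (t / u - 1)) (𝓝[>] T)
      (𝓝 ((2 * rho D * ε) ^ (t / T - 1))) := by
    refine Tendsto.mono_left ?_ nhdsWithin_le_nhds
    refine Tendsto.rpow tendsto_const_nhds ?_ (Or.inl hb0.ne')
    exact (tendsto_const_nhds.div tendsto_id hT.ne').sub_const 1
  exact ge_of_tendsto hcont (eventually_mem_nhdsWithin.mono fun u hu => key u hu)

end MaxDist

/-! ### The maximum distance of a product chain -/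

theorem prod_affinity_le (D : DistKind) {N : ℕ} {X : Fin N → Type u} {μ ν : ∀ i, X i → ℝ}
    (hμ : ∀ i, IsProb (μ i)) (hν : ∀ i, IsProb (ν i)) :
    ∏ i, affinity D (μ i) (ν i)
      ≤ affinity D (fun x : ∀ i, X i => ∏ i, μ i (x i)) fun x => ∏ i, ν i (x i) := by
  have h := hasSum_pi_prod (f := fun i x => overlap D (μ i x) (ν i x))
    (fun i x => overlap_nonneg D ((hμ i).nonneg x) ((hν i).nonneg x))
    fun i => (summable_overlap D (hμ i).nonneg (hν i).nonneg (hμ i).hasSum.summable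
      (hν i).hasSum.summable).hasSum
  have hM := isProb_pi_prod hμ
  have hN := isProb_pi_prod hν
  have hs := summable_overlap D hM.nonneg hN.nonneg hM.hasSum.summable hN.hasSum.summable
  simp only [affinity]
  rw [← h.tsum_eq]
  refine h.summable.tsum_le_tsum (fun x => ?_) hs
  exact prod_overlap_le D Finset.univ (fun i => μ i (x i)) (fun i => ν i (x i))
    (fun i => (hμ i).nonneg _) fun i => (hν i).nonneg _

theorem push_pi_prod_eval {N : ℕ} {X : Fin N → Type u} {μ : ∀ i, X i → ℝ}
    (hμ : ∀ i, IsProb (μ i)) (i : Fin N) :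
    push (fun x : ∀ i, X i => ∏ i, μ i (x i)) (fun x => idKernel (x i)) = μ i := by
  ext y
  have hy : HasSum (fun z => μ i z * idKernel z y) (μ i y) := by
    have h := ((hμ i).summable_mul isProb_idKernel y).hasSum
    rwa [sum_mul_idKernel] at h
  have h := hasSum_pi_prod (f := Function.update μ i fun z => μ i z * idKernel z y)
    (a := Function.update (fun _ => 1) i (μ i y))
    (fun j z => by
      by_cases hj : j = i
      · subst hj
        rw [Function.update_self]
        exact mul_nonneg ((hμ j).nonneg z) ((isProb_idKernel z).nonneg y)
      · rw [Function.update_of_ne hj]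
        exact (hμ j).nonneg z)
    (fun j => by
      by_cases hj : j = i
      · subst hj
        simpa only [Function.update_self] using hy
      · simpa only [Function.update_of_ne hj] using (hμ j).hasSum)
  rw [Finset.prod_update_of_mem (Finset.mem_univ i), Finset.prod_const_one, mul_one] at h
  rw [push, ← h.tsum_eq]
  refine tsum_congr fun x => ?_
  have he : ∏ j ∈ Finset.univ.erase i,
      Function.update μ i (fun z => μ i z * idKernel z y) j (x j)
      = ∏ j ∈ Finset.univ.erase i, μ j (x j) :=
    Finset.prod_congr rfl fun j hj => by rw [Function.update_of_ne (Finset.ne_of_mem_erase hj)]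
  rw [← Finset.mul_prod_erase _ (fun j => μ j (x j)) (Finset.mem_univ i),
    ← Finset.mul_prod_erase _ (fun j => Function.update μ i _ j (x j)) (Finset.mem_univ i),
    he, Function.update_self]
  ring

section ProdMaxDist

variable {N : ℕ} {X : Fin N → Type u} {K : ∀ i, X i → X i → ℝ} {π : ∀ i, X i → ℝ} {p : Fin N → ℝ}
  (D : DistKind)

/-- The weight of coordinate `i` is `p i / q`, so time `q t` of the product is time `p i t` of that
coordinate. -/
theorem prodMaxDist_eq (hN : 0 < N) (hK : ∀ i x, IsProb (K i x)) (hp : ∀ i, 0 < p i) {t : ℝ}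
    (ht : 0 ≤ t) : prodMaxDist D p K π ((∑ i, p i) * t)
      = ⨆ x : ∀ i, X i, probDist D (fun y : ∀ i, X i => ∏ i, heatKernel (K i) (p i * t) (x i) (y i))
        fun y => ∏ i, π i (y i) := by
  have hq : 0 < ∑ i, p i := Finset.sum_pos (fun i _ => hp i) ⟨⟨0, hN⟩, Finset.mem_univ _⟩
  rw [prodMaxDist, maxDist]
  refine iSup_congr fun x => ?_
  congr 1
  ext y
  rw [heatKernel_prodKernel (fun i => (div_pos (hp i) hq).le)
    (by rw [← Finset.sum_div, div_self hq.ne']) hK (by positivity)]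
  refine Finset.prod_congr rfl fun i _ => ?_
  rw [← mul_assoc, div_mul_cancel₀ _ hq.ne']

theorem prodMaxDist_le_one (hN : 0 < N) (hK : ∀ i x, IsProb (K i x)) (hπ : ∀ i, IsProb (π i))
    (hp : ∀ i, 0 < p i) {t : ℝ} (ht : 0 ≤ t) : prodMaxDist D p K π ((∑ i, p i) * t) ≤ 1 := by
  rw [prodMaxDist_eq D hN hK hp ht]
  exact Real.iSup_le (fun x => probDist_le_one D (isProb_pi_prod fun i =>
    isProb_heatKernel (hK i) (mul_nonneg (hp i).le ht) (x i)) (isProb_pi_prod hπ)) zero_le_one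

theorem prodMaxDist_nonneg (hN : 0 < N) (hK : ∀ i x, IsProb (K i x)) (hπ : ∀ i, IsProb (π i))
    (hp : ∀ i, 0 < p i) {t : ℝ} (ht : 0 ≤ t) : 0 ≤ prodMaxDist D p K π ((∑ i, p i) * t) := by
  rw [prodMaxDist_eq D hN hK hp ht]
  exact Real.iSup_nonneg fun x => probDist_nonneg D (isProb_pi_prod fun i =>
    isProb_heatKernel (hK i) (mul_nonneg (hp i).le ht) (x i)) (isProb_pi_prod hπ)

/-- Projection to coordinate `i` is a deterministic kernel, and kernels do not increase the
distance. -/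
theorem maxDist_le_prodMaxDist [∀ i, Nonempty (X i)] (hN : 0 < N) (hK : ∀ i x, IsProb (K i x))
    (hπ : ∀ i, IsProb (π i)) (hp : ∀ i, 0 < p i) {t : ℝ} (ht : 0 ≤ t) (i : Fin N) :
    maxDist D (K i) (π i) (p i * t) ≤ prodMaxDist D p K π ((∑ i, p i) * t) := by
  have hH : ∀ x : ∀ i, X i, ∀ i, IsProb (heatKernel (K i) (p i * t) (x i)) := fun x i =>
    isProb_heatKernel (hK i) (mul_nonneg (hp i).le ht) (x i)
  refine Real.iSup_le (fun z => ?_) (prodMaxDist_nonneg D hN hK hπ hp ht)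
  rw [prodMaxDist_eq D hN hK hp ht]
  obtain ⟨x, rfl⟩ : ∃ x : ∀ i, X i, x i = z :=
    ⟨Function.update (fun _ => Classical.arbitrary _) i z, Function.update_self _ _ _⟩
  refine le_ciSup_of_le ⟨1, Set.forall_mem_range.2 fun x => probDist_le_one D
    (isProb_pi_prod (hH x)) (isProb_pi_prod hπ)⟩ x ?_
  have h := probDist_push_le D (isProb_pi_prod (hH x)) (isProb_pi_prod hπ)
    (P := fun x : ∀ i, X i => idKernel (x i)) fun x => isProb_idKernel (x i)
  rwa [push_pi_prod_eval (hH x), push_pi_prod_eval hπ] at h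

theorem prodMaxDist_rpow_le (hN : 0 < N) (hK : ∀ i x, IsProb (K i x)) (hπ : ∀ i, IsProb (π i))
    (hp : ∀ i, 0 < p i) {t : ℝ} (ht : 0 ≤ t) :
    prodMaxDist D p K π ((∑ i, p i) * t) ^ rho D
      ≤ 1 - ∏ i, (1 - maxDist D (K i) (π i) (p i * t) ^ rho D) := by
  have hρ := rho_pos D
  have htp : ∀ i, 0 ≤ p i * t := fun i => mul_nonneg (hp i).le ht
  have hH : ∀ x : ∀ i, X i, ∀ i, IsProb (heatKernel (K i) (p i * t) (x i)) := fun x i =>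
    isProb_heatKernel (hK i) (htp i) (x i)
  have h0 : ∀ i, 0 ≤ maxDist D (K i) (π i) (p i * t) := fun i =>
    maxDist_nonneg D (hK i) (hπ i) (htp i)
  have h1 : ∀ i, maxDist D (K i) (π i) (p i * t) ^ rho D ≤ 1 := fun i =>
    Real.rpow_le_one (h0 i) (maxDist_le_one D (hK i) (hπ i) (htp i)) hρ.le
  have hc : 0 ≤ 1 - ∏ i, (1 - maxDist D (K i) (π i) (p i * t) ^ rho D) :=
    sub_nonneg.2 (Finset.prod_le_one (fun i _ => sub_nonneg.2 (h1 i)) fun i _ =>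
      sub_le_self _ (Real.rpow_nonneg (h0 i) _))
  rw [← Real.le_rpow_inv_iff_of_pos (prodMaxDist_nonneg D hN hK hπ hp ht) hc hρ,
    prodMaxDist_eq D hN hK hp ht]
  refine Real.iSup_le (fun x => ?_) (Real.rpow_nonneg hc _)
  rw [Real.le_rpow_inv_iff_of_pos (probDist_nonneg D (isProb_pi_prod (hH x)) (isProb_pi_prod hπ))
    hc hρ, probDist_rpow_rho D (isProb_pi_prod (hH x)) (isProb_pi_prod hπ)]
  refine sub_le_sub_left (le_trans (Finset.prod_le_prod (fun i _ => sub_nonneg.2 (h1 i))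
    fun i _ => ?_) (prod_affinity_le D (hH x) hπ)) 1
  have h2 := probDist_rpow_rho D (hH x i) (hπ i)
  have h3 := Real.rpow_le_rpow (probDist_nonneg D (hH x i) (hπ i))
    (probDist_le_maxDist D (hK i) (hπ i) (htp i) (x i)) hρ.le
  linarith

end ProdMaxDist

/-! ### Cutoffs of products -/

theorem one_sub_sum_le_prod_one_sub {ι : Type v} (S : Finset ι) {x : ι → ℝ} (h0 : ∀ i, 0 ≤ x i)
    (h1 : ∀ i, x i ≤ 1) : 1 - ∑ i ∈ S, x i ≤ ∏ i ∈ S, (1 - x i) := by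
  classical
  induction S using Finset.induction_on with
  | empty => simp
  | insert a S ha ih =>
    rw [Finset.sum_insert ha, Finset.prod_insert ha]
    have h2 := mul_le_mul_of_nonneg_left ih (sub_nonneg.2 (h1 a))
    have h3 : 0 ≤ x a * ∑ i ∈ S, x i := mul_nonneg (h0 a) (Finset.sum_nonneg fun i _ => h0 i)
    nlinarith

theorem one_le_rho (D : DistKind) : 1 ≤ rho D := by
  cases D <;> norm_num [rho]

theorem card_last_le (N m : ℕ) : (Finset.univ.filter fun i : Fin N => ¬ i.val + m < N).card ≤ m := by
  calc (Finset.univ.filter fun i : Fin N => ¬ i.val + m < N).card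
      ≤ (Finset.range m).card := by
        refine Finset.card_le_card_of_injOn (fun i => N - 1 - i.val) (fun i hi => ?_) ?_
        · simp only [Finset.coe_filter, Finset.mem_univ, true_and, Set.mem_ofPred_eq] at hi
          simp only [Finset.coe_range, Set.mem_Iio]
          have := i.isLt
          omega
        · intro i _ j _ hij
          simp only at hij
          have := i.isLt
          have := j.isLt
          exact Fin.ext (by omega)
    _ = m := Finset.card_range m

/-- Only finitely many positions from the end are involved, so eventual statements at each position
hold simultaneously. -/
theorem eventually_last {k : ℕ → ℕ} (hk_pos : ∀ n, 0 < k n) {Q : ∀ n, Fin (k n) → Prop} (m : ℕ)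
    (h : ∀ l, ∀ᶠ n in atTop, Q n (fromEnd (hk_pos n) l)) :
    ∀ᶠ n in atTop, ∀ i : Fin (k n), k n ≤ i.val + m → Q n i := by
  have hall : ∀ᶠ n in atTop, ∀ l ∈ Finset.range m, Q n (fromEnd (hk_pos n) l) :=
    (Finset.eventually_all _).2 fun l _ => h l
  filter_upwards [hall] with n hn i hi
  have hlt := i.isLt
  have := hn (k n - 1 - i.val) (Finset.mem_range.2 (by omega))
  rwa [show fromEnd (hk_pos n) (k n - 1 - i.val) = i from Fin.ext (by simp [fromEnd]; omega)] at this

theorem TailVanishes.exists_eventually_lt {D : DistKind} {k : ℕ → ℕ} {ε p T : ∀ n, Fin (k n) → ℝ}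
    {c : ℝ} (h : TailVanishes D ε p T c) {δ : ℝ} (hδ : 0 < δ) :
    ∃ m, ∀ᶠ n in atTop, tailSum D (ε n) (p n) (T n) c m < δ := by
  obtain ⟨m, hm⟩ := (h.eventually_lt_const (ENNReal.ofReal_pos.2 hδ)).exists
  exact ⟨m, (eventually_lt_of_limsup_lt hm).mono fun n hn => (ENNReal.ofReal_lt_ofReal_iff hδ).1 hn⟩

theorem le_maxRatio {N : ℕ} (a p : Fin N → ℝ) (i : Fin N) : a i / p i ≤ maxRatio a p :=
  le_ciSup (f := fun i => a i / p i) (Set.finite_range _).bddAbove i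

theorem exists_eq_maxRatio {N : ℕ} (hN : 0 < N) (a p : Fin N → ℝ) :
    ∃ i, a i / p i = maxRatio a p := by
  have : Nonempty (Fin N) := ⟨⟨0, hN⟩⟩
  exact exists_eq_ciSup_of_finite

theorem maxRatio_pos {N : ℕ} (hN : 0 < N) {a p : Fin N → ℝ} (ha : ∀ i, 0 < a i)
    (hp : ∀ i, 0 < p i) : 0 < maxRatio a p :=
  (div_pos (ha ⟨0, hN⟩) (hp _)).trans_le (le_maxRatio a p ⟨0, hN⟩)

/-- The relations between the distances `d i` of the coordinate chains, their mixing times `T i` at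
level `ε i` and the distance `P` of the product chain with weights `p` from which cutoffs of
products are derived. -/
structure IsProductProfile (D : DistKind) {N : ℕ} (p ε T : Fin N → ℝ) (d : Fin N → ℝ → ℝ)
    (q : ℝ) (P : ℝ → ℝ) : Prop where
  p_pos : ∀ i, 0 < p i
  q_pos : 0 < q
  eps_pos : ∀ i, 0 < ε i
  eps_lt : ∀ i, ε i < 1 / (2 * rho D)
  T_pos : ∀ i, 0 < T i
  nonneg : ∀ i t, 0 ≤ t → 0 ≤ d i t
  le_one : ∀ i t, 0 ≤ t → d i t ≤ 1
  anti : ∀ i s t, 0 ≤ s → s ≤ t → d i t ≤ d i s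
  le_eps : ∀ i t, T i < t → d i t ≤ ε i
  eps_lt_of_lt : ∀ i t, 0 ≤ t → t < T i → ε i < d i t
  le_rpow : ∀ i t, 0 ≤ t → d i t ≤ (2 * rho D * ε i) ^ (t / T i - 1)
  prod_nonneg : ∀ t, 0 ≤ t → 0 ≤ P (q * t)
  prod_le_one : ∀ t, 0 ≤ t → P (q * t) ≤ 1
  le_prod : ∀ i t, 0 ≤ t → d i (p i * t) ≤ P (q * t)
  prod_rpow_le : ∀ t, 0 ≤ t → P (q * t) ^ rho D ≤ 1 - ∏ i, (1 - d i (p i * t) ^ rho D)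

namespace IsProductProfile

variable {D : DistKind} {N : ℕ} {p ε T : Fin N → ℝ} {d : Fin N → ℝ → ℝ} {q : ℝ} {P : ℝ → ℝ}

theorem base_pos (h : IsProductProfile D p ε T d q P) (i : Fin N) : 0 < 2 * rho D * ε i :=
  mul_pos (mul_pos two_pos (rho_pos D)) (h.eps_pos i)

theorem base_lt_one (h : IsProductProfile D p ε T d q P) (i : Fin N) : 2 * rho D * ε i < 1 := by
  have := h.eps_lt i
  have hρ := rho_pos D
  rw [lt_div_iff₀ (by positivity)] at this
  linarith

theorem eps_lt_half (h : IsProductProfile D p ε T d q P) (i : Fin N) : ε i < 1 / 2 := by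
  nlinarith [h.base_lt_one i, one_le_rho D, h.eps_pos i]

theorem T_le (h : IsProductProfile D p ε T d q P) (i : Fin N) : T i ≤ p i * maxRatio T p := by
  have := le_maxRatio T p i
  rw [div_le_iff₀ (h.p_pos i)] at this
  linarith

theorem rpow_mem (h : IsProductProfile D p ε T d q P) (i : Fin N) {t : ℝ} (ht : 0 ≤ t) :
    0 ≤ d i (p i * t) ^ rho D ∧ d i (p i * t) ^ rho D ≤ 1 := by
  have h0 : 0 ≤ p i * t := mul_nonneg (h.p_pos i).le ht
  exact ⟨Real.rpow_nonneg (h.nonneg i _ h0) _,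
    Real.rpow_le_one (h.nonneg i _ h0) (h.le_one i _ h0) (rho_pos D).le⟩

theorem rpow_le_self (h : IsProductProfile D p ε T d q P) (i : Fin N) {t : ℝ} (ht : 0 ≤ t) :
    d i (p i * t) ^ rho D ≤ d i (p i * t) := by
  have h0 : 0 ≤ p i * t := mul_nonneg (h.p_pos i).le ht
  rcases (h.nonneg i _ h0).eq_or_lt with h1 | h1
  · rw [← h1, Real.zero_rpow (rho_pos D).ne']
  · simpa using Real.rpow_le_rpow_of_exponent_ge h1 (h.le_one i _ h0) (one_le_rho D)

/-- Exponential decay at a time at least `c s` produces the terms of the tail sum; the `-1` in the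
exponent of `le_rpow` becomes the constant, uniform because `ε i ≥ α`. -/
theorem sum_tail_le (h : IsProductProfile D p ε T d q P) {α : ℝ} (hα : 0 < α)
    (hαε : ∀ i, α ≤ ε i) {c t : ℝ} (ht : 0 ≤ t) (hct : c * maxRatio T p ≤ t) (m : ℕ) :
    ∑ i with i.val + m < N, d i (p i * t) ^ rho D
      ≤ (2 * rho D * α) ^ (-rho D) * tailSum D ε p T c m := by
  have hρ := rho_pos D
  rw [tailSum, Finset.mul_sum]
  refine Finset.sum_le_sum fun i _ => ?_
  have hp := h.p_pos i
  have hT := h.T_pos i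
  have hb := h.base_pos i
  have h0 : 0 ≤ p i * t := mul_nonneg hp.le ht
  calc d i (p i * t) ^ rho D
      ≤ ((2 * rho D * ε i) ^ (p i * t / T i - 1)) ^ rho D :=
        Real.rpow_le_rpow (h.nonneg i _ h0) (h.le_rpow i _ h0) hρ.le
    _ = (2 * rho D * ε i) ^ (-rho D) * (2 * rho D * ε i) ^ (rho D * (p i * t / T i)) := by
        rw [← Real.rpow_mul hb.le, ← Real.rpow_add hb]
        congr 1; ring
    _ ≤ (2 * rho D * α) ^ (-rho D) *
        (2 * rho D * ε i) ^ (c * rho D * maxRatio T p * p i / T i) := by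
        gcongr ?_ * ?_
        · refine Real.rpow_le_rpow_of_nonpos (by positivity) ?_ (by linarith)
          have := hαε i
          gcongr
        · refine Real.rpow_le_rpow_of_exponent_ge hb (h.base_lt_one i).le ?_
          calc c * rho D * maxRatio T p * p i / T i
              = rho D * (p i * (c * maxRatio T p) / T i) := by ring
            _ ≤ rho D * (p i * t / T i) := by gcongr

/-- An index with `s p_i / T_i ≤ C` contributes at least `(2ϱα) ^ (cϱC)`, too much for a small tail
sum to contain it. -/
theorem le_add_of_tailSum_lt (h : IsProductProfile D p ε T d q P) {α : ℝ} (hα : 0 < α)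
    (hαε : ∀ i, α ≤ ε i) {c C : ℝ} (hc : 0 ≤ c) (hC : 0 ≤ C) {m : ℕ}
    (hm : tailSum D ε p T c m < (2 * rho D * α) ^ (c * rho D * C)) {i : Fin N}
    (hi : maxRatio T p * p i / T i ≤ C) : N ≤ i.val + m := by
  by_contra! hlt
  have hρ := rho_pos D
  have hb := h.base_pos i
  refine absurd hm (not_lt.2 ?_)
  calc (2 * rho D * α) ^ (c * rho D * C) ≤ (2 * rho D * ε i) ^ (c * rho D * C) := by
        have := hαε i
        gcongr
    _ ≤ (2 * rho D * ε i) ^ (c * rho D * maxRatio T p * p i / T i) := by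
        refine Real.rpow_le_rpow_of_exponent_ge hb (h.base_lt_one i).le ?_
        calc c * rho D * maxRatio T p * p i / T i = c * rho D * (maxRatio T p * p i / T i) := by ring
          _ ≤ c * rho D * C := by gcongr
    _ ≤ tailSum D ε p T c m :=
        Finset.single_le_sum
          (f := fun i => (2 * rho D * ε i) ^ (c * rho D * maxRatio T p * p i / T i))
          (fun j _ => Real.rpow_nonneg (h.base_pos j).le _)
          (Finset.mem_filter.2 ⟨Finset.mem_univ i, hlt⟩)

/-- Union bound: `1 - ∏ (1 - x_i) ≤ ∑ x_i`, with at most `m` terms from the last indices. -/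
theorem prod_rpow_le_of_last_le (h : IsProductProfile D p ε T d q P) {α : ℝ} (hα : 0 < α)
    (hαε : ∀ i, α ≤ ε i) {c t η : ℝ} (ht : 0 ≤ t) (hct : c * maxRatio T p ≤ t) {m : ℕ}
    (hη : 0 ≤ η) (hlast : ∀ i : Fin N, N ≤ i.val + m → d i (p i * t) ≤ η) :
    P (q * t) ^ rho D ≤ (2 * rho D * α) ^ (-rho D) * tailSum D ε p T c m + m * η := by
  have h1 := one_sub_sum_le_prod_one_sub Finset.univ (fun i => (h.rpow_mem i ht).1)
    fun i => (h.rpow_mem i ht).2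
  have h2 := Finset.sum_filter_add_sum_filter_not Finset.univ (fun i : Fin N => i.val + m < N)
    fun i => d i (p i * t) ^ rho D
  have h3 := h.sum_tail_le hα hαε ht hct m
  have h4 : ∑ i with ¬ i.val + m < N, d i (p i * t) ^ rho D ≤ m * η := by
    refine (Finset.sum_le_card_nsmul _ _ η fun i hi => ?_).trans ?_
    · exact (h.rpow_le_self i ht).trans (hlast i (not_lt.1 (Finset.mem_filter.1 hi).2))
    · rw [nsmul_eq_mul]
      have : ((Finset.univ.filter fun i : Fin N => ¬ i.val + m < N).card : ℝ) ≤ m := by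
        exact_mod_cast card_last_le N m
      gcongr
  linarith [h.prod_rpow_le t ht]

/-- Here the last coordinates may be far from equilibrium, so their factors are kept as a product,
at least `η ^ m`; the union bound is used only for the others, whose product is at least `1 / 2`. -/
theorem prod_rpow_le_of_tail_le (h : IsProductProfile D p ε T d q P) {α : ℝ} (hα : 0 < α)
    (hαε : ∀ i, α ≤ ε i) {c t η : ℝ} (ht : 0 ≤ t) (hct : c * maxRatio T p ≤ t) {m : ℕ}
    (htail : (2 * rho D * α) ^ (-rho D) * tailSum D ε p T c m ≤ 1 / 2)
    (hη : 0 ≤ η) (hη1 : η ≤ 1) (hlast : ∀ i : Fin N, N ≤ i.val + m → d i (p i * t) ≤ 1 - η) :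
    P (q * t) ^ rho D ≤ 1 - η ^ m / 2 := by
  have h1 := one_sub_sum_le_prod_one_sub (Finset.univ.filter fun i : Fin N => i.val + m < N)
    (fun i => (h.rpow_mem i ht).1) fun i => (h.rpow_mem i ht).2
  have h2 := Finset.prod_filter_mul_prod_filter_not Finset.univ (fun i : Fin N => i.val + m < N)
    fun i => 1 - d i (p i * t) ^ rho D
  have h3 := h.sum_tail_le hα hαε ht hct m
  have h4 : η ^ m ≤ ∏ i with ¬ i.val + m < N, (1 - d i (p i * t) ^ rho D) := by
    calc η ^ m ≤ η ^ (Finset.univ.filter fun i : Fin N => ¬ i.val + m < N).card :=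
          pow_le_pow_of_le_one hη hη1 (card_last_le N m)
      _ = ∏ i : Fin N with ¬ i.val + m < N, η := (Finset.prod_const _).symm
      _ ≤ _ := Finset.prod_le_prod (fun _ _ => hη) fun i hi => by
          have := (h.rpow_le_self i ht).trans (hlast i (not_lt.1 (Finset.mem_filter.1 hi).2))
          linarith
  have h5 : 1 / 2 * η ^ m ≤ ∏ i, (1 - d i (p i * t) ^ rho D) := by
    rw [← h2]
    exact mul_le_mul (by linarith) h4 (by positivity)
      (Finset.prod_nonneg fun i _ => sub_nonneg.2 (h.rpow_mem i ht).2)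
  linarith [h.prod_rpow_le t ht]

end IsProductProfile

/-! ### Sequences of products: both parts of the theorem for abstract profiles -/

section Families

variable {D : DistKind} {k : ℕ → ℕ} {p ε T : ∀ n, Fin (k n) → ℝ} {d : ∀ n, Fin (k n) → ℝ → ℝ}
  {q : ℕ → ℝ} {P : ℕ → ℝ → ℝ} {α : ℝ} {τ : ∀ n, Fin (k n) → ℝ}

/-- After the cutoff the distance falls below `α ≤ ε`, so `T ≤ a τ`; the reverse comparison in
`eventually_le_T` holds because before the cutoff it exceeds `1 / 2 > ε`. Thus `T` and `τ` are
asymptotically equal at the last `m` indices. -/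
theorem eventually_T_le (hk_pos : ∀ n, 0 < k n)
    (h : ∀ n, IsProductProfile D (p n) (ε n) (T n) (d n) (q n) (P n))
    (hα : 0 < α) (hαε : ∀ n i, α ≤ ε n i)
    (hcut : ∀ m : ℕ, HasCutoffAt (fun n => d n (fromEnd (hk_pos n) m))
      (fun n => τ n (fromEnd (hk_pos n) m))) {a : ℝ} (ha : 1 < a) (m : ℕ) :
    ∀ᶠ n in atTop, ∀ i : Fin (k n), k n ≤ i.val + m → T n i ≤ a * τ n i := by
  refine eventually_last hk_pos m fun l => ?_
  filter_upwards [((hcut l).2.1 a ha).eventually_lt_const hα] with n hn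
  by_contra! hlt
  have h0 : 0 ≤ a * τ n (fromEnd (hk_pos n) l) := mul_nonneg (by linarith) ((hcut l).1 n).le
  linarith [(h n).eps_lt_of_lt _ _ h0 hlt, hαε n (fromEnd (hk_pos n) l)]

theorem eventually_le_T (hk_pos : ∀ n, 0 < k n)
    (h : ∀ n, IsProductProfile D (p n) (ε n) (T n) (d n) (q n) (P n))
    (hcut : ∀ m : ℕ, HasCutoffAt (fun n => d n (fromEnd (hk_pos n) m))
      (fun n => τ n (fromEnd (hk_pos n) m))) {a : ℝ} (ha0 : 0 < a) (ha : a < 1) (m : ℕ) :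
    ∀ᶠ n in atTop, ∀ i : Fin (k n), k n ≤ i.val + m → a * τ n i ≤ T n i := by
  refine eventually_last hk_pos m fun l => ?_
  filter_upwards [((hcut l).2.2 a ha0 ha).eventually_const_lt (by norm_num : (1 / 2 : ℝ) < 1)]
    with n hn
  by_contra! hlt
  linarith [(h n).le_eps _ _ hlt, (h n).eps_lt_half (fromEnd (hk_pos n) l)]

theorem exists_eventually_last (h : ∀ n, IsProductProfile D (p n) (ε n) (T n) (d n) (q n) (P n))
    (hα : 0 < α) (hαε : ∀ n i, α ≤ ε n i) {c C : ℝ} (hc : 0 ≤ c) (hC : 0 ≤ C)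
    (htail : TailVanishes D ε p T c) :
    ∃ m : ℕ, ∀ᶠ n in atTop, ∀ i : Fin (k n),
      maxRatio (T n) (p n) * p n i / T n i ≤ C → k n ≤ i.val + m := by
  have hρ := rho_pos D
  obtain ⟨m, hm⟩ := htail.exists_eventually_lt
    (δ := (2 * rho D * α) ^ (c * rho D * C)) (by positivity)
  exact ⟨m, hm.mono fun n hn i hi => (h n).le_add_of_tailSum_lt hα (hαε n) hc hC hn hi⟩

/-- A maximizer of `T_i / p_i` has `s p_i / T_i = 1`, so the index constraint applies with `C = 1`.
-/
theorem exists_eventually_maximizer (hk_pos : ∀ n, 0 < k n)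
    (h : ∀ n, IsProductProfile D (p n) (ε n) (T n) (d n) (q n) (P n))
    (hα : 0 < α) (hαε : ∀ n i, α ≤ ε n i) {c : ℝ} (hc : 0 ≤ c) (htail : TailVanishes D ε p T c) :
    ∃ m : ℕ, ∀ᶠ n in atTop, ∃ i : Fin (k n),
      p n i * maxRatio (T n) (p n) = T n i ∧ k n ≤ i.val + m := by
  obtain ⟨m, hm⟩ := exists_eventually_last h hα hαε hc zero_le_one htail
  refine ⟨m, hm.mono fun n hn => ?_⟩
  obtain ⟨i, hi⟩ := exists_eq_maxRatio (hk_pos n) (T n) (p n)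
  have hp := (h n).p_pos i
  have hT := (h n).T_pos i
  have he : p n i * maxRatio (T n) (p n) = T n i := by rw [← hi]; field_simp
  exact ⟨i, he, hn i (by rw [mul_comm, he, div_self hT.ne'])⟩

theorem hasCutoffAt_prod (hk_pos : ∀ n, 0 < k n)
    (h : ∀ n, IsProductProfile D (p n) (ε n) (T n) (d n) (q n) (P n))
    (hα : 0 < α) (hαε : ∀ n i, α ≤ ε n i)
    (htail : ∀ c : ℝ, 1 < c → TailVanishes D ε p T c)
    (hcut : ∀ m : ℕ, HasCutoffAt (fun n => d n (fromEnd (hk_pos n) m))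
      (fun n => τ n (fromEnd (hk_pos n) m))) (hτ : ∀ n i, 0 < τ n i) :
    HasCutoffAt P (fun n => q n * maxRatio (T n) (p n)) := by
  have hρ := rho_pos D
  have hs : ∀ n, 0 < maxRatio (T n) (p n) := fun n =>
    maxRatio_pos (hk_pos n) (h n).T_pos (h n).p_pos
  have hcomm : ∀ (a : ℝ) n, a * (q n * maxRatio (T n) (p n)) = q n * (a * maxRatio (T n) (p n)) :=
    fun a n => by ring
  refine ⟨fun n => mul_pos (h n).q_pos (hs n), fun a ha => ?_, fun a ha0 ha => ?_⟩
  · have ha0 : 0 < a := by linarith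
    simp_rw [hcomm]
    have h0 : ∀ n, 0 ≤ a * maxRatio (T n) (p n) := fun n => mul_nonneg ha0.le (hs n).le
    rw [tendsto_order]
    refine ⟨fun b hb => Eventually.of_forall fun n => hb.trans_le ((h n).prod_nonneg _ (h0 n)),
      fun δ hδ => ?_⟩
    have hC : 0 < (2 * rho D * α) ^ (-rho D) := by positivity
    have hδρ : 0 < δ ^ rho D := by positivity
    obtain ⟨m, hm⟩ := (htail a ha).exists_eventually_lt
      (δ := δ ^ rho D / 2 / (2 * rho D * α) ^ (-rho D)) (by positivity)
    -- Half of `δ ^ ϱ` is allotted to the tail and half to the at most `m` last coordinates; `m + 1`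
    -- avoids division by zero.
    set η : ℝ := δ ^ rho D / 2 / (m + 1) with hη
    have hηpos : 0 < η := by positivity
    have hsmall : ∀ᶠ n in atTop, ∀ i : Fin (k n), k n ≤ i.val + m →
        d n i ((1 + a) / 2 * τ n i) < η :=
      eventually_last hk_pos m fun l =>
        ((hcut l).2.1 _ (by linarith)).eventually_lt_const hηpos
    -- The midpoint of `1` and `a` leaves room for replacing `τ` by `T`: `(1 + a) / 2 * τ ≤ a * T ≤
    -- p_i * (a * s)`.
    have hT := eventually_le_T hk_pos h hcut (a := (1 + a) / 2 / a) (by positivity)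
      (by rw [div_lt_one ha0]; linarith) m
    filter_upwards [hm, hsmall, hT] with n hn hsn hTn
    have hlast : ∀ i : Fin (k n), k n ≤ i.val + m →
        d n i (p n i * (a * maxRatio (T n) (p n))) ≤ η := by
      intro i hi
      refine ((h n).anti i _ _ (mul_nonneg (by linarith) (hτ n i).le) ?_).trans (hsn i hi).le
      calc (1 + a) / 2 * τ n i = a * ((1 + a) / 2 / a * τ n i) := by field_simp
        _ ≤ a * T n i := by gcongr; exact hTn i hi
        _ ≤ a * (p n i * maxRatio (T n) (p n)) := by gcongr; exact (h n).T_le i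
        _ = p n i * (a * maxRatio (T n) (p n)) := by ring
    have hP := (h n).prod_rpow_le_of_last_le hα (hαε n) (h0 n) le_rfl hηpos.le hlast
    have h1 : (2 * rho D * α) ^ (-rho D) * tailSum D (ε n) (p n) (T n) a m < δ ^ rho D / 2 := by
      rw [lt_div_iff₀ hC] at hn; linarith
    have h2 : m * η ≤ δ ^ rho D / 2 := by
      rw [hη, mul_div_assoc', div_le_iff₀ (by positivity)]
      nlinarith
    exact (Real.rpow_lt_rpow_iff ((h n).prod_nonneg _ (h0 n)) hδ.le hρ).1 (by linarith)
  · simp_rw [hcomm]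
    have h0 : ∀ n, 0 ≤ a * maxRatio (T n) (p n) := fun n => mul_nonneg ha0.le (hs n).le
    rw [tendsto_order]
    refine ⟨fun b hb => ?_, fun b hb => Eventually.of_forall fun n =>
      ((h n).prod_le_one _ (h0 n)).trans_lt hb⟩
    -- Any `c > 1` serves to locate the maximizer.
    obtain ⟨m, hm⟩ := exists_eventually_maximizer hk_pos h hα hαε (c := 2) (by norm_num)
      (htail 2 (by norm_num))
    have hlarge : ∀ᶠ n in atTop, ∀ i : Fin (k n), k n ≤ i.val + m →
        b < d n i ((1 + a) / 2 * τ n i) :=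
      eventually_last hk_pos m fun l =>
        ((hcut l).2.2 _ (by linarith) (by linarith)).eventually_const_lt hb
    have hT := eventually_T_le hk_pos h hα hαε hcut (a := (1 + a) / 2 / a)
      (by rw [one_lt_div ha0]; linarith) m
    filter_upwards [hm, hlarge, hT] with n hn hln hTn
    obtain ⟨i, he, hi⟩ := hn
    refine (hln i hi).trans_le (((h n).anti i _ _ ?_ ?_).trans ((h n).le_prod i _ (h0 n)))
    · exact mul_nonneg ((h n).p_pos i).le (h0 n)
    · calc p n i * (a * maxRatio (T n) (p n)) = a * T n i := by rw [← he]; ring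
        _ ≤ a * ((1 + a) / 2 / a * τ n i) := by gcongr; exact hTn i hi
        _ = (1 + a) / 2 * τ n i := by field_simp

theorem eventually_maxRatio_le (hk_pos : ∀ n, 0 < k n)
    (h : ∀ n, IsProductProfile D (p n) (ε n) (T n) (d n) (q n) (P n))
    (hα : 0 < α) (hαε : ∀ n i, α ≤ ε n i)
    (htail : ∀ c : ℝ, 1 < c → TailVanishes D ε p T c)
    (hcut : ∀ m : ℕ, HasCutoffAt (fun n => d n (fromEnd (hk_pos n) m))
      (fun n => τ n (fromEnd (hk_pos n) m))) {a : ℝ} (ha : 1 < a) :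
    ∀ᶠ n in atTop, maxRatio (T n) (p n) ≤ a * maxRatio (τ n) (p n) := by
  obtain ⟨m, hm⟩ := exists_eventually_maximizer hk_pos h hα hαε (c := 2) (by norm_num)
    (htail 2 (by norm_num))
  filter_upwards [hm, eventually_T_le hk_pos h hα hαε hcut ha m] with n hn hT
  obtain ⟨i, he, hi⟩ := hn
  have hp := (h n).p_pos i
  calc maxRatio (T n) (p n) = T n i / p n i := by rw [← he]; field_simp
    _ ≤ a * τ n i / p n i := by gcongr; exact hT i hi
    _ = a * (τ n i / p n i) := by ring
    _ ≤ a * maxRatio (τ n) (p n) := by gcongr; exact le_maxRatio _ _ i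

theorem eventually_maxRatio_le_of_bounded (hk_pos : ∀ n, 0 < k n)
    (h : ∀ n, IsProductProfile D (p n) (ε n) (T n) (d n) (q n) (P n))
    (hα : 0 < α) (hαε : ∀ n i, α ≤ ε n i)
    (htail : ∀ c : ℝ, 1 < c → TailVanishes D ε p T c)
    (hcut : ∀ m : ℕ, HasCutoffAt (fun n => d n (fromEnd (hk_pos n) m))
      (fun n => τ n (fromEnd (hk_pos n) m))) {C : ℝ} (hC : ∀ n i, τ n i / T n i ≤ C)
    (hτ : ∀ n i, 0 < τ n i) {a : ℝ} (ha : 1 < a) :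
    ∀ᶠ n in atTop, maxRatio (τ n) (p n) ≤ a * maxRatio (T n) (p n) := by
  have hC0 : 0 ≤ C := (div_nonneg (hτ 0 ⟨0, hk_pos 0⟩).le ((h 0).T_pos _).le).trans (hC 0 _)
  have ha0 : 0 < a := by linarith
  obtain ⟨m, hm⟩ := exists_eventually_last h hα hαε (c := 2) (by norm_num) hC0
    (htail 2 (by norm_num))
  filter_upwards [hm, eventually_le_T hk_pos h hcut (inv_pos.2 ha0) (inv_lt_one_of_one_lt₀ ha) m]
    with n hn hT
  obtain ⟨i, hi⟩ := exists_eq_maxRatio (hk_pos n) (τ n) (p n)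
  have hp := (h n).p_pos i
  have hTi := (h n).T_pos i
  have hs := maxRatio_pos (hk_pos n) (h n).T_pos (h n).p_pos
  rw [← hi]
  -- If the maximum of `τ_i / p_i` exceeds `s`, its index satisfies `s p_i / T_i ≤ τ_i / T_i ≤ C`,
  -- so it is among the last `m`, where `τ ≤ a T`.
  rcases le_or_gt (τ n i / p n i) (maxRatio (T n) (p n)) with hle | hlt
  · nlinarith
  · have hlast : k n ≤ i.val + m := by
      refine hn i (le_trans ?_ (hC n i))
      rw [lt_div_iff₀ hp] at hlt
      gcongr
    have h1 : τ n i ≤ a * T n i := by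
      have := hT i hlast
      rwa [inv_mul_le_iff₀ ha0] at this
    calc τ n i / p n i ≤ a * T n i / p n i := by gcongr
      _ = a * (T n i / p n i) := by ring
      _ ≤ a * maxRatio (T n) (p n) := by gcongr; exact le_maxRatio _ _ i

theorem exists_subfamily_hasCutoffAt (hk_pos : ∀ n, 0 < k n)
    (h : ∀ n, IsProductProfile D (p n) (ε n) (T n) (d n) (q n) (P n))
    (hα : 0 < α) (hαε : ∀ n i, α ≤ ε n i) {c : ℝ} (hc0 : 0 < c) (hc1 : c < 1)
    (htail : TailVanishes D ε p T c) {v : ℕ → ℝ} (hcut : HasCutoffAt P v) :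
    ∃ (j : ℕ → ℕ) (J : ∀ r, Fin (k (j r))), StrictMono j ∧
      (∃ M : ℕ, ∀ r, k (j r) ≤ (J r).val + M) ∧
      HasCutoffAt (fun r => d (j r) (J r)) (fun r => p (j r) (J r) * v (j r) / q (j r)) := by
  have hρ := rho_pos D
  obtain ⟨hv, hcut0, hcut1⟩ := hcut
  have hu : ∀ n, 0 < v n / q n := fun n => div_pos (hv n) (h n).q_pos
  have hqu : ∀ n (a : ℝ), a * v n = q n * (a * (v n / q n)) := fun n a => by
    have := (h n).q_pos
    field_simp
  have hC : 0 < (2 * rho D * α) ^ (-rho D) := by positivity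
  obtain ⟨m, hm⟩ := htail.exists_eventually_lt (δ := 1 / 2 / (2 * rho D * α) ^ (-rho D))
    (by positivity)
  -- Shortly before the product cutoff some coordinate among the last `m` is almost singular to
  -- equilibrium.
  have key : ∀ a η : ℝ, c < a → a < 1 → 0 < η → η ≤ 1 → ∀ᶠ n in atTop, ∃ i : Fin (k n),
      k n ≤ i.val + m ∧ 1 - η < d n i (p n i * (a * (v n / q n))) := by
    intro a η hca ha hη hη1
    have ha0 : 0 < a := hc0.trans hca
    have h1 : ∀ᶠ n in atTop, P n (a / c * v n) < α :=
      (hcut0 _ ((one_lt_div hc0).2 hca)).eventually_lt_const hα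
    have h2 : Tendsto (fun n => P n (a * v n) ^ rho D) atTop (𝓝 1) := by
      have := (hcut1 a ha0 ha).rpow_const (p := rho D) (Or.inr hρ.le)
      rwa [Real.one_rpow] at this
    have h3 : ∀ᶠ n in atTop, 1 - η ^ m / 2 < P n (a * v n) ^ rho D :=
      h2.eventually_const_lt (by linarith [pow_pos hη m])
    filter_upwards [hm, h1, h3] with n hmn h1n h3n
    by_contra! hcon
    have hau : 0 ≤ a * (v n / q n) := mul_nonneg ha0.le (hu n).le
    -- Since `a / c > 1`, the product at time `(a / c) v`, hence every coordinate, is closer than `α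
    -- ≤ ε_i`. This bounds each `T_i`, and the tail sum at `c` then controls time `a v` although `a
    -- < 1`.
    have hs : c * maxRatio (T n) (p n) ≤ a * (v n / q n) := by
      obtain ⟨i, hi⟩ := exists_eq_maxRatio (hk_pos n) (T n) (p n)
      have hp := (h n).p_pos i
      have hacu : 0 ≤ a / c * (v n / q n) := mul_nonneg (by positivity) (hu n).le
      have h4 : T n i ≤ p n i * (a / c * (v n / q n)) := by
        by_contra! hlt
        have h5 := (h n).eps_lt_of_lt i _ (mul_nonneg hp.le hacu) hlt
        have h6 := (h n).le_prod i _ hacu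
        rw [← hqu] at h6
        linarith [hαε n i]
      calc c * maxRatio (T n) (p n) = c * (T n i / p n i) := by rw [hi]
        _ ≤ c * (p n i * (a / c * (v n / q n)) / p n i) := by gcongr
        _ = a * (v n / q n) := by field_simp
    have h7 := (h n).prod_rpow_le_of_tail_le hα (hαε n) hau hs
      (by rw [lt_div_iff₀ hC] at hmn; linarith) hη.le hη1 hcon
    rw [← hqu] at h7
    linarith
  -- Diagonal choice: the times `1 - (1 - c) / (r + 2)` lie in `(c, 1)` and tend to `1`, while `η =
  -- 1 / (r + 1)` tends to `0`. By monotonicity this single choice of indices serves every `a < 1`.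
  obtain ⟨j, hj, hJ⟩ := extraction_forall_of_eventually fun r : ℕ =>
    key (1 - (1 - c) / (r + 2)) (1 / (r + 1))
      (by
        have : (1 - c) / ((r : ℝ) + 2) < 1 - c :=
          div_lt_self (by linarith) (by linarith [(Nat.cast_nonneg r : (0 : ℝ) ≤ r)])
        linarith)
      (by
        have : 0 < (1 - c) / ((r : ℝ) + 2) := div_pos (by linarith) (by positivity)
        linarith)
      (by positivity)
      (by
        rw [div_le_one (by positivity)]
        linarith [(Nat.cast_nonneg r : (0 : ℝ) ≤ r)])
  choose J hJm hJd using hJ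
  have hcomm : ∀ (a : ℝ) r, a * (p (j r) (J r) * v (j r) / q (j r))
      = p (j r) (J r) * (a * (v (j r) / q (j r))) := fun a r => by ring
  refine ⟨j, J, hj, ⟨m, hJm⟩, fun r => ?_, fun a ha => ?_, fun a ha0 ha => ?_⟩
  · exact div_pos (mul_pos ((h _).p_pos _) (hv _)) (h _).q_pos
  · simp_rw [hcomm]
    have h0 : ∀ r, 0 ≤ a * (v (j r) / q (j r)) := fun r => mul_nonneg (by linarith) (hu _).le
    refine squeeze_zero (fun r => (h _).nonneg _ _ (mul_nonneg ((h _).p_pos _).le (h0 r)))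
      (fun r => ?_) ((hcut0 a ha).comp hj.tendsto_atTop)
    have := (h (j r)).le_prod (J r) _ (h0 r)
    rwa [← hqu] at this
  · simp_rw [hcomm]
    have h0 : ∀ r, 0 ≤ a * (v (j r) / q (j r)) := fun r => mul_nonneg ha0.le (hu _).le
    have hlim : Tendsto (fun r : ℕ => 1 - 1 / ((r : ℝ) + 1)) atTop (𝓝 1) := by
      simpa using tendsto_one_div_add_atTop_nhds_zero_nat.const_sub (1 : ℝ)
    have hlim2 : Tendsto (fun r : ℕ => 1 - (1 - c) / ((r : ℝ) + 2)) atTop (𝓝 1) := by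
      have := (tendsto_const_nhds (x := 1 - c)).div_atTop
        (tendsto_atTop_add_const_right atTop (2 : ℝ) tendsto_natCast_atTop_atTop)
      simpa using this.const_sub 1
    refine tendsto_of_tendsto_of_tendsto_of_le_of_le' hlim tendsto_const_nhds ?_
      (Eventually.of_forall fun r => (h _).le_one _ _ (mul_nonneg ((h _).p_pos _).le (h0 r)))
    filter_upwards [hlim2.eventually_const_lt ha] with r hr
    refine (hJd r).le.trans ((h _).anti _ _ _ (mul_nonneg ((h _).p_pos _).le (h0 r)) ?_)
    have hp := (h (j r)).p_pos (J r)
    have := hu (j r)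
    gcongr

end Families

theorem limsup_div_le_one {s t : ℕ → ℝ} (ht : ∀ n, 0 < t n)
    (h : ∀ a : ℝ, 1 < a → ∀ᶠ n in atTop, s n ≤ a * t n) :
    limsup (fun n => ((s n / t n : ℝ) : EReal)) atTop ≤ 1 := by
  -- In `EReal` the limsup is meaningful without a bound on the ratios, and it suffices to test
  -- against real `a > 1`.
  refine EReal.le_of_forall_lt_iff_le.1 fun a ha => ?_
  have ha' : 1 < a := by exact_mod_cast ha
  refine limsup_le_of_le (by isBoundedDefault) ((h a ha').mono fun n hn => ?_)
  exact EReal.coe_le_coe_iff.2 ((div_le_iff₀ (ht n)).2 hn)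

theorem tendsto_div_one {s t : ℕ → ℝ} (hs : ∀ n, 0 < s n) (ht : ∀ n, 0 < t n)
    (h : ∀ a : ℝ, 1 < a → ∀ᶠ n in atTop, s n ≤ a * t n)
    (h' : ∀ a : ℝ, 1 < a → ∀ᶠ n in atTop, t n ≤ a * s n) :
    Tendsto (fun n => s n / t n) atTop (𝓝 1) := by
  rw [tendsto_order]
  refine ⟨fun b hb => ?_, fun b hb => ?_⟩
  · rcases le_or_gt b 0 with hb0 | hb0
    · exact Eventually.of_forall fun n => hb0.trans_lt (div_pos (hs n) (ht n))
    · obtain ⟨a, ha1, hab⟩ := exists_between ((one_lt_div hb0).2 hb)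
      refine (h' a ha1).mono fun n hn => (lt_div_iff₀ (ht n)).2 ?_
      rw [lt_div_iff₀ hb0] at hab
      calc b * t n ≤ b * (a * s n) := by gcongr
        _ = a * b * s n := by ring
        _ < 1 * s n := by have := hs n; gcongr
        _ = s n := one_mul _
  · obtain ⟨a, ha1, hab⟩ := exists_between hb
    exact (h a ha1).mono fun n hn => ((div_le_iff₀ (ht n)).2 hn).trans_lt hab

/-- The probabilistic input ends here: the cutoff arguments use only these inequalities between real
functions. -/
theorem isProductProfile (D : DistKind) {N : ℕ} (hN : 0 < N) {X : Fin N → Type u}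
    [∀ i, Nontrivial (X i)] {K : ∀ i, X i → X i → ℝ} {π : ∀ i, X i → ℝ}
    (hchain : ∀ i, IsIrreducibleChain (K i) (π i)) {p : Fin N → ℝ} (hp : ∀ i, 0 < p i)
    {ε : Fin N → ℝ} (hε : ∀ i, 0 < ε i ∧ ε i < 1 / (2 * rho D))
    (hfin : ∀ i, MixingTimeFinite D (K i) (π i) (ε i)) :
    IsProductProfile D p ε (fun i => mixingTime D (K i) (π i) (ε i))
      (fun i => maxDist D (K i) (π i)) (∑ i, p i) (prodMaxDist D p K π) := by
  have hK : ∀ i x, IsProb (K i x) := fun i => (hchain i).isProb_row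
  have hπ : ∀ i, IsProb (π i) := fun i => (hchain i).isProb_pi
  have hst : ∀ i, push (π i) (K i) = π i := fun i => (hchain i).push_eq
  exact
    { p_pos := hp
      q_pos := Finset.sum_pos (fun i _ => hp i) ⟨⟨0, hN⟩, Finset.mem_univ _⟩
      eps_pos := fun i => (hε i).1
      eps_lt := fun i => (hε i).2
      T_pos := fun i => mixingTime_pos D (hK i) (hπ i) (hst i) (hε i).1 (hε i).2 (hfin i)
      nonneg := fun i t ht => maxDist_nonneg D (hK i) (hπ i) ht
      le_one := fun i t ht => maxDist_le_one D (hK i) (hπ i) ht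
      anti := fun i s t hs hst' => maxDist_le_of_le D (hK i) (hπ i) (hst i) hs hst'
      le_eps := fun i t ht => maxDist_le_of_mixingTime_lt D (hK i) (hπ i) (hst i) (hfin i) ht
      eps_lt_of_lt := fun i t ht0 ht => lt_maxDist_of_lt_mixingTime D ht0 ht
      le_rpow := fun i t ht => maxDist_le_rpow D (hK i) (hπ i) (hst i) (hε i).1 (hε i).2 (hfin i) ht
      prod_nonneg := fun t ht => prodMaxDist_nonneg D hN hK hπ hp ht
      prod_le_one := fun t ht => prodMaxDist_le_one D hN hK hπ hp ht
      le_prod := fun i t ht => maxDist_le_prodMaxDist D hN hK hπ hp ht i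
      prod_rpow_le := fun t ht => prodMaxDist_rpow_le D hN hK hπ hp ht }

end ProductChain

theorem theorem4p3
    (D : ProductChain.DistKind)
    (k : ℕ → ℕ) (hk_pos : ∀ n, 0 < k n) (hk : Tendsto k atTop atTop)
    (X : ∀ n, Fin (k n) → Type*) [∀ n i, Countable (X n i)] [∀ n i, Nontrivial (X n i)]
    (K : ∀ n i, X n i → X n i → ℝ) (π : ∀ n i, X n i → ℝ)
    (hchain : ∀ n i, IsIrreducibleChain (K n i) (π n i))
    (p : ∀ n, Fin (k n) → ℝ) (hp : ∀ n i, 0 < p n i)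
    (ε : ∀ n, Fin (k n) → ℝ)
    (hε : ∀ n i, 0 < ε n i ∧ ε n i < 1 / (2 * rho D))
    (hε_inf : ∃ α : ℝ, 0 < α ∧ ∀ n i, α ≤ ε n i)
    (T : ∀ n, Fin (k n) → ℝ)
    (hT_fin : ∀ n i, MixingTimeFinite D (K n i) (π n i) (ε n i))
    (hT : ∀ n i, T n i = mixingTime D (K n i) (π n i) (ε n i))
    (s : ℕ → ℝ) (hs : ∀ n, s n = maxRatio (T n) (p n))
    (q : ℕ → ℝ) (hq : ∀ n, q n = ∑ i, p n i) :
    (∀ τ : ∀ n, Fin (k n) → ℝ, (∀ n i, 0 < τ n i) →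
      (∀ c : ℝ, 1 < c → TailVanishes D ε p T c) →
      (∀ m : ℕ, HasCutoffAt
        (fun n => maxDist D (K n (fromEnd (hk_pos n) m)) (π n (fromEnd (hk_pos n) m)))
        (fun n => τ n (fromEnd (hk_pos n) m))) →
      HasCutoffAt (fun n => prodMaxDist D (p n) (K n) (π n)) (fun n => q n * s n) ∧
      limsup (fun n => ((s n / maxRatio (τ n) (p n) : ℝ) : EReal)) atTop ≤ 1 ∧
      ((∃ C : ℝ, ∀ n i, τ n i / T n i ≤ C) →
        Tendsto (fun n => s n / maxRatio (τ n) (p n)) atTop (𝓝 1))) ∧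
    (∀ v : ℕ → ℝ,
      (∃ c : ℝ, 0 < c ∧ c < 1 ∧ TailVanishes D ε p T c) →
      HasCutoffAt (fun n => prodMaxDist D (p n) (K n) (π n)) v →
      ∃ (j : ℕ → ℕ) (J : ∀ r, Fin (k (j r))),
        StrictMono j ∧
        (∃ M : ℕ, ∀ r, k (j r) ≤ (J r).val + M) ∧
        HasCutoffAt (fun r => maxDist D (K (j r) (J r)) (π (j r) (J r)))
          (fun r => p (j r) (J r) * v (j r) / q (j r))) := by
  obtain ⟨α, hα, hαε⟩ := hε_inf
  obtain rfl : T = fun n i => mixingTime D (K n i) (π n i) (ε n i) :=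
    funext fun n => funext fun i => hT n i
  obtain rfl : s = fun n => maxRatio (fun i => mixingTime D (K n i) (π n i) (ε n i)) (p n) :=
    funext hs
  obtain rfl : q = fun n => ∑ i, p n i := funext hq
  have h := fun n => isProductProfile D (hk_pos n) (hchain n) (hp n) (hε n) (hT_fin n)
  have hs0 := fun n => maxRatio_pos (hk_pos n) (h n).T_pos (h n).p_pos
  refine ⟨fun τ hτ htail hcut => ⟨?_, ?_, ?_⟩, ?_⟩
  · exact hasCutoffAt_prod hk_pos h hα hαε htail hcut hτ
  · exact limsup_div_le_one (fun n => maxRatio_pos (hk_pos n) (hτ n) (hp n)) fun a ha =>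
      eventually_maxRatio_le hk_pos h hα hαε htail hcut ha
  · rintro ⟨C, hC⟩
    exact tendsto_div_one hs0 (fun n => maxRatio_pos (hk_pos n) (hτ n) (hp n))
      (fun a ha => eventually_maxRatio_le hk_pos h hα hαε htail hcut ha)
      fun a ha => eventually_maxRatio_le_of_bounded hk_pos h hα hαε htail hcut hC hτ ha
  · rintro v ⟨c, hc0, hc1, htail⟩ hcut
    exact exists_subfamily_hasCutoffAt hk_pos h hα hαε hc0 hc1 htail hcut
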